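/- Consider the one-dimensional reactive Navier--Stokes system for $U=(\tau,u,E,z)$ (specific volume, velocity, total energy, reactant mass fraction; $\tau>0$, $E>0$, $0\le z\le 1$) in a frame moving with speed $s>0$, $$\partial_t U+\partial_x F(U)=\partial_x(B(U)\partial_x U)+G(U),\qquad F(U)=(-u,\,p,\,pu,\,0)-sU,\qquad G(U)=(0,0,0,-k\phi(T)z),$$ $$B(U)\,\partial_xU=\big(0,\ \nu\tau^{-1}\partial_xu,\ \kappa\tau^{-1}\partial_xT+\nu\tau^{-1}u\,\partial_xu+qd\tau^{-2}\partial_xz,\ d\tau^{-2}\partial_xz\big),$$ with $\nu,\kappa,d,k>0$, $q\in\mathbb R$, internal energy $e=E-\tfrac12u^2-qz>0$, and the ideal gas law $p=\Gamma\tau^{-1}e$, $T=c^{-1}e$ with constants $c,\Gamma>0$. The ignition function $\phi$ is smooth, vanishes for $T\le T_i$ and is positive for $T>T_i$. Let $\sigma(U)=\tau^{-1}(\Gamma(\Gamma+1)e)^{1/2}$ be the sound speed. A family of (right-going) viscous strong detonations is a family $\{\bar U^\varepsilon\}_{\varepsilon\in\mathbb R}$ of smooth bounded functions of $x\in\mathbb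 R$ such that: $\bar U^\varepsilon$ is a stationary solution of the system with parameters $(s,\nu,\kappa,d,k,q)(\varepsilon)$ and ignition function $\phi^\varepsilon$ (with $c,\Gamma,T_i$ independent of $\varepsilon$); $\varepsilon\mapsto\bar U^\varepsilon\in L^\infty(\mathbb R)$, $\varepsilon\mapsto(s,\nu,\kappa,d,k,q)(\varepsilon)$ and $(\varepsilon,T)\mapsto\phi^\varepsilon(T)$ are $C^\infty$; and, for each $\varepsilon$, $\bar U^\varepsilon(x)\to U^\varepsilon_\pm$ as $x\to\pm\infty$, where the endstates $U^\varepsilon_\pm$ are in the physical range above, $z^\varepsilon_-=0$, $z^\varepsilon_+=1$, $T^\varepsilon_->T_i$ and $\sigma(U^\varepsilon_-)>s(\varepsilon)>\sigma(U^\varepsilon_+)$. Let $\{\bar U^\varepsilon\}_\varepsilon$ be such a family, with $T^\varepsilon_+<T_i$ for all $\varepsilon$. Then: (1) For all $k\ge0$ and $x\in\mathbb R$, $\partial_x^k(\bar U^\varepsilon-U^\varepsilon_\pm)(x)$ is a differentiable function of $\varepsilon$. For every compact $K\subset\mathbb R$ there is $\eta_0>0$ such that for every $k\ge 0$ there is $C>0$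 with, for all $\varepsilon\in K$ and $j\in\{0,1\}$, $$|\partial_\varepsilon^j\partial_x^k(\bar U^\varepsilon-U^\varepsilon_-)(x)|\le Ce^{-\eta_0|x|}\quad(x<0),\qquad |\partial_\varepsilon^j\partial_x^k(\bar U^\varepsilon-U^\varepsilon_+)(x)|\le Ce^{-\eta_0|x|}\quad(x>0).$$ (2) Fix $\varepsilon$ (dropped from the notation), and let $X'=\mathfrak F(X)$ be the traveling-wave ODE for $X=(u,E,z,y)$, $y=z'$: with $\tau=\tau_--(u-u_-)/s$, $$\nu\tau^{-1}u'=p-su-(p-su)_-,\qquad \kappa c^{-1}\tau^{-1}E'+(\nu-\kappa c^{-1})\tau^{-1}uu'=pu-sE-(pu-sE)_-+(\kappa c^{-1}\tau^{-1}-d\tau^{-2})qy,$$ $$z'=y,\qquad (d\tau^{-2}y)'=-sy+k\phi(T)z.$$ Then $X_+=(u_+,E_+,1,0)$ is an equilibrium, $0$ is an algebraically simple eigenvalue of $D\mathfrak F(X_+)$, and its other complex eigenvalues have negative real part. There is a local center manifold of class $C^1$ at $X_+$ (a regular $C^1$ curve through $X_+$, tangent there to $\ker D\mathfrak F(X_+)$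 and locally invariant), and every such center manifold consists, near $X_+$, of equilibria. -/

import Mathlib

open Filter Topology
open scoped ContDiff Matrix BoundedContinuousFunction

namespace Detonation

/-- States `U = (τ, u, E, z)`: specific volume, velocity, total specific energy and
mass fraction of the reactant. -/
abbrev State := Fin 4 → ℝ

/-- The constants and the ignition function of the one-dimensional reactive Navier-Stokes
system (Lagrangian coordinates) with a reaction-independent ideal gas law, together with the
speed `s` of the frame. -/
structure Model where
  /-- specific heat -/
  c : ℝ
  /-- Gruneisen constant -/
  Γ : ℝ
  /-- viscosity -/
  ν : ℝ
  /-- heat conduction -/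
  κ : ℝ
  /-- species diffusion -/
  d : ℝ
  /-- reaction rate -/
  k : ℝ
  /-- heat release -/
  q : ℝ
  /-- speed of the travelling wave -/
  s : ℝ
  /-- ignition function -/
  φ : ℝ → ℝ

namespace Model

noncomputable section

variable (M : Model)

/-- Specific internal energy `e`, given by `E = e + u² / 2 + q z`. -/
def internalEnergy (U : State) : ℝ := U 2 - U 1 ^ 2 / 2 - M.q * U 3

/-- Ideal gas pressure `p = Γ e / τ`. -/
def pressure (U : State) : ℝ := M.Γ * M.internalEnergy U / U 0

/-- Ideal gas temperature `T = e / c`. -/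
def temperature (U : State) : ℝ := M.internalEnergy U / M.c

/-- Sound speed `σ = (p p_e - p_τ)^(1/2) = τ⁻¹ (Γ (Γ + 1) e)^(1/2)`. -/
def soundSpeed (U : State) : ℝ := Real.sqrt (M.Γ * (M.Γ + 1) * M.internalEnergy U) / U 0

/-- The physical range of the state variables. -/
structure IsPhysical (U : State) : Prop where
  volume_pos : 0 < U 0
  energy_pos : 0 < U 2
  internalEnergy_pos : 0 < M.internalEnergy U
  fraction_nonneg : 0 ≤ U 3
  fraction_le_one : U 3 ≤ 1

/-- The flux `F(U) = (-u, p, p u, 0) - s U` in the frame moving with speed `s`. -/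
def flux (U : State) : State :=
  ![-U 1, M.pressure U, M.pressure U * U 1, 0] - M.s • U

/-- The viscosity matrix `B(U)`, for `T = e / c`. -/
def viscosity (U : State) : Matrix (Fin 4) (Fin 4) ℝ :=
  !![0, 0, 0, 0;
     0, M.ν / U 0, 0, 0;
     0, (M.ν - M.κ / M.c) * U 1 / U 0, M.κ / (M.c * U 0),
       M.q * M.d / U 0 ^ 2 - M.q * M.κ / (M.c * U 0);
     0, 0, 0, M.d / U 0 ^ 2]

/-- The reaction term `G(U) = (0, 0, 0, -k φ(T) z)`. -/
def source (U : State) : State :=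
  ![0, 0, 0, -(M.k * M.φ (M.temperature U) * U 3)]

/-- `U` is a stationary solution of `∂ₜ U + ∂ₓ F(U) = ∂ₓ (B(U) ∂ₓ U) + G(U)`. -/
def IsStationary (U : ℝ → State) : Prop :=
  ∀ x : ℝ, deriv (fun y => M.flux (U y)) x
    = deriv (fun y => M.viscosity (U y) *ᵥ deriv U y) x + M.source (U x)

/-- The right-hand side of the travelling-wave ordinary differential equation for
`X = (u, E, z, y)` with `y = z'`, obtained by integrating the first three stationary
equations from the left endstate `Um`:
`τ = τ₋ - (u - u₋) / s`,
`ν τ⁻¹ u' = (p - s u) - (p - s u)₋`,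
`κ c⁻¹ τ⁻¹ E' + (ν - κ c⁻¹) τ⁻¹ u u'
  = (p u - s E) - (p u - s E)₋ + (κ c⁻¹ τ⁻¹ - d τ⁻²) q y`,
`z' = y` and `(d τ⁻² y)' = -s y + k φ(T) z`. -/
def waveField (Um : State) (X : Fin 4 → ℝ) : Fin 4 → ℝ :=
  let τ : ℝ := Um 0 - (X 0 - Um 1) / M.s
  let U : State := ![τ, X 0, X 1, X 2]
  let u' : ℝ := τ / M.ν *
    ((M.pressure U - M.s * X 0) - (M.pressure Um - M.s * Um 1))
  let E' : ℝ := M.c * τ / M.κ *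
    ((M.pressure U * X 0 - M.s * X 1) - (M.pressure Um * Um 1 - M.s * Um 2)
      + (M.κ / (M.c * τ) - M.d / τ ^ 2) * M.q * X 3
      - (M.ν - M.κ / M.c) / τ * X 0 * u')
  let τ' : ℝ := -u' / M.s
  let y' : ℝ := τ ^ 2 / M.d * (-M.s * X 3 + M.k * M.φ (M.temperature U) * X 2)
    + 2 * τ' / τ * X 3
  ![u', E', X 3, y']

end

end Model

/-- An ignition function with ignition temperature `Ti`. -/
structure IsIgnition (Ti : ℝ) (φ : ℝ → ℝ) : Prop where
  smooth : ContDiff ℝ ∞ φ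
  eq_zero : ∀ T ≤ Ti, φ T = 0
  pos : ∀ T, Ti < T → 0 < φ T

/-- `U` is a right-going viscous strong detonation profile with burned left endstate `Um`
and unburned right endstate `Up`. -/
structure IsStrongDetonation (Ti : ℝ) (M : Model) (U : ℝ → State) (Um Up : State) : Prop where
  viscosity_pos : 0 < M.ν
  conduction_pos : 0 < M.κ
  diffusion_pos : 0 < M.d
  rate_pos : 0 < M.k
  speed_pos : 0 < M.s
  ignition : IsIgnition Ti M.φ
  smooth : ContDiff ℝ ∞ U
  physical : ∀ x, M.IsPhysical (U x)
  physical_left : M.IsPhysical Um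
  physical_right : M.IsPhysical Up
  stationary : M.IsStationary U
  tendsto_left : Tendsto U atBot (𝓝 Um)
  tendsto_right : Tendsto U atTop (𝓝 Up)
  burned_left : Um 3 = 0
  unburned_right : Up 3 = 1
  ignited_left : Ti < M.temperature Um
  lax_left : M.s < M.soundSpeed Um
  lax_right : M.soundSpeed Up < M.s

/-- A one-parameter family of viscous strong detonations of a gas with constants `c`, `Γ` and
ignition temperature `Ti`. The profiles depend smoothly on `ε` in the sup norm, the ignition
functions depend smoothly on `ε` and on the temperature. -/
structure IsStrongDetonationFamily (c Γ Ti : ℝ) (M : ℝ → Model) (U : ℝ → (ℝ →ᵇ State))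
    (Um Up : ℝ → State) : Prop where
  specificHeat : ∀ ε, (M ε).c = c
  gruneisen : ∀ ε, (M ε).Γ = Γ
  smooth_s : ContDiff ℝ ∞ fun ε => (M ε).s
  smooth_ν : ContDiff ℝ ∞ fun ε => (M ε).ν
  smooth_κ : ContDiff ℝ ∞ fun ε => (M ε).κ
  smooth_d : ContDiff ℝ ∞ fun ε => (M ε).d
  smooth_k : ContDiff ℝ ∞ fun ε => (M ε).k
  smooth_q : ContDiff ℝ ∞ fun ε => (M ε).q
  smooth_φ : ContDiff ℝ ∞ fun a : ℝ × ℝ => (M a.1).φ a.2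
  smooth_U : ContDiff ℝ ∞ U
  detonation : ∀ ε, IsStrongDetonation Ti (M ε) (U ε) (Um ε) (Up ε)

/-- `∂_ε^j ∂_x^k (U^ε - V^ε)(x)`. -/
noncomputable def mixedDeriv (U : ℝ → (ℝ →ᵇ State)) (V : ℝ → State) (j k : ℕ) (ε x : ℝ) :
    State :=
  iteratedDeriv j (fun e : ℝ => iteratedDeriv k (fun y : ℝ => U e y - V e) x) ε

/-- The equilibrium `X₀` of `X' = f(X)` has a one-dimensional center subspace, namely a simple
eigenvalue `0` of the linearization, and all other eigenvalues are stable. -/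
def HasSimpleCenter (f : (Fin 4 → ℝ) → Fin 4 → ℝ) (X₀ : Fin 4 → ℝ) : Prop :=
  let A : Matrix (Fin 4) (Fin 4) ℂ :=
    (LinearMap.toMatrix' (fderiv ℝ f X₀ : (Fin 4 → ℝ) →ₗ[ℝ] Fin 4 → ℝ)).map (fun a => (a : ℂ))
  f X₀ = 0 ∧ A.charpoly.rootMultiplicity 0 = 1 ∧
    ∀ μ : ℂ, A.charpoly.IsRoot μ → μ = 0 ∨ μ.re < 0

/-- Near `t = 0` the regular `C¹` curve `γ` parametrizes a local center manifold of `X' = f(X)`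
at `X₀`, when the center subspace is one-dimensional and equal to the kernel of the
linearization: it is tangent to this kernel at `X₀` and locally invariant, that is, the vector
field is tangent to it. -/
structure IsCenterCurve (f : (Fin 4 → ℝ) → Fin 4 → ℝ) (X₀ : Fin 4 → ℝ) (γ : ℝ → Fin 4 → ℝ) :
    Prop where
  smooth : ContDiffAt ℝ 1 γ 0
  through : γ 0 = X₀
  regular : deriv γ 0 ≠ 0
  tangent : fderiv ℝ f X₀ (deriv γ 0) = 0
  invariant : ∀ᶠ t in 𝓝 (0 : ℝ), ∃ a : ℝ, f (γ t) = a • deriv γ t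

end Detonation

/-!
Integrating the stationary equations once, from either endstate `B`, turns the profile equation
into a first order system for the velocity `u`, the internal energy `e`, the mass fraction `z` and
the flux `d τ⁻² z' + s z` of the reactant. Relative to their values at `B` these are the
coordinates `waveCoord`, and the field `profileField` is polynomial in them, apart from the
reaction rate (`IsStrongDetonation.hasDerivAt_waveCoord`). The perturbation `U - B` is a
polynomial in these coordinates, so each of its `x`-derivatives is a smooth function of the
coordinates and of the parameter that vanishes at the origin. It therefore suffices to estimate
the coordinates, and one rate serves all orders of differentiation.

Regularity in the parameter. The endstates depend smoothly on `ε`, because limits at infinity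
extend to bounded linear functionals on the bounded continuous functions. The flux of the reactant
is monotone in `x` and, since `T₊ < Ti`, equal to `s` for large `x`, so that it is `s` minus an
integral of the reaction rate over a bounded interval; this makes it a `C¹` function of `ε` with
values controlled through the profile alone.

Exponential decay. If `A` is the linearization at an endstate, there is a quadratic form `Q` with
`Q(v, A v)` positive definite: the gas-dynamical block of `A` is symmetric up to a positive
diagonal factor and nondegenerate by the Lax conditions, and so is, by `φ(T₋) > 0`, the reaction
block at the burned endstate. Along any solution converging to the endstate, `Q` satisfies a scalar
differential inequality which forces exponential decay (`exists_norm_le_exp_of_quadratic_form`). At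
the unburned endstate `A` has the eigenvalue `0`, because the flux of the reactant is conserved
without reaction; but on the profile this coordinate vanishes identically for large `x`, so its
equation may be replaced by a relaxation. The same inequality, applied to the difference of the
profiles for two parameters, which solves the linearized equation up to a small term and an
exponentially decaying forcing, bounds the difference quotients in `ε` and hence the derivative
`∂_ε`.

Center manifolds. Near the unburned endstate there is no reaction. The linearization is then block
triangular and its eigenvalues can be read off. The equilibria satisfy `y = 0` and two balance
laws, which determine `u` as a root of a quadratic polynomial with coefficients affine in `z`; they
form a center curve. Conversely, tangency of the field to a curve with components `z` and `y` says
`y = a ż` and `-μ y = a ẏ` for some `a`, where `μ > 0` near the endstate, hence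
`a (ẏ + μ ż) = 0`. The second factor does not vanish near the endstate, since the kernel of the
linearization is contained in `y = 0` and transversal to `z = const`. So `a = 0` and the field
vanishes on the curve.
-/

namespace Detonation

/-! ### Exponential decay from an indefinite quadratic form -/

/-- Scalar form of the decay estimate. A function `q` tending to `0` at `-∞` with
`q' ≥ a |q| - P exp (2 β (x - x₀))` decays exponentially, whatever its sign: where it is negative
it is bounded below by the integral of the forcing, and where it is positive it grows at least like
`exp (a x)`, so that it must have been small before. -/
theorem abs_le_exp_of_deriv_ge {q q' : ℝ → ℝ} {x₀ a β P : ℝ} (ha : 0 < a) (haβ : a ≤ β)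
    (hP : 0 ≤ P) (hq : ∀ x ≤ x₀, HasDerivAt q (q' x) x)
    (hq' : ∀ x ≤ x₀, a * |q x| - P * Real.exp (2 * β * (x - x₀)) ≤ q' x)
    (hlim : Tendsto q atBot (𝓝 0)) {x : ℝ} (hx : x ≤ x₀) :
    |q x| ≤ (|q x₀| + P / β) * Real.exp (a * (x - x₀)) := by
  have hβ : 0 < β := ha.trans_le haβ
  have hexp : ∀ r x : ℝ, HasDerivAt (fun y => Real.exp (r * (y - x₀)))
      (Real.exp (r * (x - x₀)) * r) x := fun r x => by
    simpa using (((hasDerivAt_id x).sub_const x₀).const_mul r).exp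
  -- a differentiable function on `(-∞, x₀]` with nonnegative derivative is monotone
  have hmono : ∀ f f' : ℝ → ℝ, (∀ x ≤ x₀, HasDerivAt f (f' x) x) → (∀ x ≤ x₀, 0 ≤ f' x) →
      MonotoneOn f (Set.Iic x₀) := fun f f' hf hf' =>
    monotoneOn_of_deriv_nonneg (convex_Iic _)
      (fun x hx => (hf x hx).continuousAt.continuousWithinAt)
      (fun x hx => (hf x (interior_subset (s := Set.Iic x₀) hx)).differentiableAt
        |>.differentiableWithinAt)
      (fun x hx => by
        have hx' := interior_subset (s := Set.Iic x₀) hx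
        rw [(hf x hx').deriv]; exact hf' x hx')
  have hea : Real.exp (2 * β * (x - x₀)) ≤ Real.exp (a * (x - x₀)) := by
    apply Real.exp_le_exp.2
    nlinarith [mul_nonneg (sub_nonneg.2 hx) (by linarith : (0:ℝ) ≤ 2 * β - a)]
  rw [abs_le]
  constructor
  -- `q + P / (2 β) exp (2 β (x - x₀))` increases from its limit `0`
  · have hm := hmono (fun y => q y + P / (2 * β) * Real.exp (2 * β * (y - x₀))) _
      (fun y hy => (hq y hy).add ((hexp (2 * β) y).const_mul _)) (fun y hy => by
        have h1 := hq' y hy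
        have h2 := mul_nonneg ha.le (abs_nonneg (q y))
        have h3 : P / (2 * β) * (Real.exp (2 * β * (y - x₀)) * (2 * β))
          = P * Real.exp (2 * β * (y - x₀)) := by field_simp
        linarith)
    have hl : Tendsto (fun y => q y + P / (2 * β) * Real.exp (2 * β * (y - x₀))) atBot
        (𝓝 (0 + P / (2 * β) * 0)) := by
      refine hlim.add (Tendsto.const_mul _ (Real.tendsto_exp_atBot.comp ?_))
      exact (tendsto_atBot_add_const_right _ (-x₀) tendsto_id).const_mul_atBot (by positivity)
    have h0 : 0 + P / (2 * β) * 0 ≤ q x + P / (2 * β) * Real.exp (2 * β * (x - x₀)) := by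
      refine le_of_tendsto hl ?_
      filter_upwards [eventually_le_atBot x] with y hy
      exact hm (hy.trans hx) hx hy
    have h1 : P / (2 * β) * Real.exp (2 * β * (x - x₀)) ≤ P / β * Real.exp (a * (x - x₀)) := by
      gcongr
      linarith
    have h2 := mul_nonneg (abs_nonneg (q x₀)) (Real.exp_pos (a * (x - x₀))).le
    nlinarith
  -- `q exp (-a (x - x₀))` increases up to the forcing, which gives a bound by its value at `x₀`
  · have hm := hmono (fun y => q y * Real.exp (-a * (y - x₀))
        + P / (2 * β - a) * Real.exp ((2 * β - a) * (y - x₀))) _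
      (fun y hy => ((hq y hy).mul (hexp (-a) y)).add ((hexp (2 * β - a) y).const_mul _))
      (fun y hy => by
        have h1 := hq' y hy
        have h2 := mul_le_mul_of_nonneg_left (le_abs_self (q y)) ha.le
        have h4 : 0 < 2 * β - a := by linarith
        have h3 : P / (2 * β - a) * (Real.exp ((2 * β - a) * (y - x₀)) * (2 * β - a))
          = P * Real.exp (2 * β * (y - x₀)) * Real.exp (-a * (y - x₀)) := by
          rw [mul_assoc P, ← Real.exp_add,
            show (2 * β * (y - x₀) + -a * (y - x₀)) = (2 * β - a) * (y - x₀) by ring]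
          field_simp
        have h5 := Real.exp_pos (-a * (y - x₀))
        rw [h3]
        nlinarith)
    have h0 := hm hx (le_refl x₀) hx
    simp only [sub_self, mul_zero, Real.exp_zero, mul_one] at h0
    have h1 : P / (2 * β - a) ≤ P / β := by
      apply div_le_div_of_nonneg_left hP hβ; linarith
    have h2 : 0 ≤ P / (2 * β - a) * Real.exp ((2 * β - a) * (x - x₀)) := by
      have : 0 < 2 * β - a := by linarith
      positivity
    have h3 : q x * Real.exp (-a * (x - x₀)) ≤ |q x₀| + P / β := by
      linarith [le_abs_self (q x₀)]
    calc q x = q x * Real.exp (-a * (x - x₀)) * Real.exp (a * (x - x₀)) := by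
          rw [mul_assoc, ← Real.exp_add]; simp
      _ ≤ _ := by gcongr

section
variable {E : Type*} [NormedAddCommGroup E] [NormedSpace ℝ E]

set_option maxHeartbeats 1000000 in
/-- Decay at `-∞` of solutions of `D' = A D + o(D) + O(exp (β x))` for a linear map `A` that
admits a, possibly indefinite, quadratic form `Q` with `Q(v, A v)` positive definite. No splitting
into stable and unstable subspaces is used: `Q(D, D)` satisfies the hypothesis of
`abs_le_exp_of_deriv_ge`, and its derivative dominates `‖D‖²`, so that the mean value theorem
bounds `‖D‖` at some point of each unit interval. The constants do not depend on the solution. -/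
theorem exists_norm_le_exp_of_quadratic_form (Q : E →L[ℝ] E →L[ℝ] ℝ)
    (hsymm : ∀ v w, Q v w = Q w v) (A : E →L[ℝ] E) {c β : ℝ} (hc : 0 < c) (hβ : 0 < β)
    (hQ : ∀ v, c * ‖v‖ ^ 2 ≤ Q v (A v)) :
    ∃ η > 0, ∃ δ > 0, ∃ C > 0, ∀ (x₀ B : ℝ) (D D' : ℝ → E), 0 ≤ B →
      (∀ x ≤ x₀, HasDerivAt D (D' x) x) →
      (∀ x ≤ x₀, ‖D' x - A (D x)‖ ≤ δ * ‖D x‖ + B * Real.exp (β * (x - x₀))) →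
      Tendsto D atBot (𝓝 0) →
      ∀ x ≤ x₀, ‖D x‖ ≤ C * (‖D x₀‖ + B) * Real.exp (η * (x - x₀)) := by
  obtain ⟨m, hm⟩ : ∃ y : ℝ, y = ‖Q‖ + 1 := ⟨_, rfl⟩
  have hm0 : 0 < m := by rw [hm]; positivity
  have hQm : ∀ v w, |Q v w| ≤ m * ‖v‖ * ‖w‖ := fun v w => by
    refine (Q.le_opNorm₂ v w).trans ?_
    gcongr
    linarith [hm]
  obtain ⟨δ, hδ⟩ : ∃ y : ℝ, y = c / (4 * m) := ⟨_, rfl⟩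
  have hδ0 : 0 < δ := by rw [hδ]; positivity
  obtain ⟨a, ha⟩ : ∃ y : ℝ, y = min (c / m) β := ⟨_, rfl⟩
  have ha0 : 0 < a := by rw [ha]; exact lt_min (by positivity) hβ
  have haβ : a ≤ β := by rw [ha]; exact min_le_right _ _
  have ham : a * m ≤ c := by
    have := min_le_left (c / m) β
    rwa [← ha, le_div_iff₀ hm0] at this
  obtain ⟨K, hK⟩ : ∃ y : ℝ, y = ‖A‖ + δ := ⟨_, rfl⟩
  have hK0 : 0 < K := by rw [hK]; positivity
  obtain ⟨k₁, hk₁⟩ : ∃ y : ℝ, y = (2 * m + (2 / β + 1) * (2 * m ^ 2 / c)) / c := ⟨_, rfl⟩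
  have hk₁0 : 0 < k₁ := by rw [hk₁]; positivity
  refine ⟨a / 2, by positivity, δ, hδ0, (Real.sqrt k₁ + 1 / K) * Real.exp K, by positivity, ?_⟩
  intro x₀ B D D' hB hD hD' hlim x hx
  obtain ⟨P, hP⟩ : ∃ y : ℝ, y = 2 * m ^ 2 / c * B ^ 2 := ⟨_, rfl⟩
  have hP0 : 0 ≤ P := by rw [hP]; positivity
  have hq : ∀ x ≤ x₀, HasDerivAt (fun y => Q (D y) (D y)) (2 * Q (D x) (D' x)) x := by
    intro x hx
    have h := (Q.hasFDerivAt.comp_hasDerivAt x (hD x hx)).clm_apply (hD x hx)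
    refine h.congr_deriv ?_
    rw [hsymm (D' x), Function.comp_apply]; ring
  -- the derivative of the quadratic form along `D`
  have hq' : ∀ x ≤ x₀, c * ‖D x‖ ^ 2 - P * Real.exp (2 * β * (x - x₀)) ≤ 2 * Q (D x) (D' x) := by
    intro x hx
    have h1 := hQ (D x)
    have h2 : Q (D x) (D' x) = Q (D x) (A (D x)) + Q (D x) (D' x - A (D x)) := by
      rw [← map_add]; congr 1; abel
    have h3 := (abs_le.1 (hQm (D x) (D' x - A (D x)))).1
    have h4 := hD' x hx
    set f := B * Real.exp (β * (x - x₀)) with hf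
    have h5 : P * Real.exp (2 * β * (x - x₀)) = 2 * m ^ 2 / c * f ^ 2 := by
      rw [hP, hf, mul_pow, ← Real.exp_nat_mul]; push_cast; ring_nf
    have h6 : m * ‖D x‖ * ‖D' x - A (D x)‖ ≤ m * ‖D x‖ * (δ * ‖D x‖ + f) := by gcongr
    have h7 : m * ‖D x‖ * (δ * ‖D x‖ + f) = c / 4 * ‖D x‖ ^ 2 + m * ‖D x‖ * f := by
      rw [hδ]; field_simp
    have h8 : 2 * (m * ‖D x‖ * f) ≤ c / 2 * ‖D x‖ ^ 2 + 2 * m ^ 2 / c * f ^ 2 := by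
      have : c / 2 * ‖D x‖ ^ 2 + 2 * m ^ 2 / c * f ^ 2 - 2 * (m * ‖D x‖ * f)
        = (c * ‖D x‖ - 2 * m * f) ^ 2 / (2 * c) := by field_simp; ring
      have h9 : 0 ≤ (c * ‖D x‖ - 2 * m * f) ^ 2 / (2 * c) := by positivity
      linarith
    rw [h5, h2]
    nlinarith [sq_nonneg ‖D x‖]
  have hqm : ∀ x, |Q (D x) (D x)| ≤ m * ‖D x‖ ^ 2 := fun x => by
    have := hQm (D x) (D x)
    nlinarith
  have hqlim : Tendsto (fun y => Q (D y) (D y)) atBot (𝓝 0) := by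
    refine squeeze_zero_norm (a := fun y => m * ‖D y‖ ^ 2) hqm ?_
    simpa using (hlim.norm.pow 2).const_mul m
  have hqexp : ∀ x ≤ x₀, |Q (D x) (D x)| ≤
      (|Q (D x₀) (D x₀)| + P / β) * Real.exp (a * (x - x₀)) := by
    intro x hx
    refine abs_le_exp_of_deriv_ge (q := fun y => Q (D y) (D y)) ha0 haβ hP0 hq ?_ hqlim hx
    intro y hy
    refine le_trans ?_ (hq' y hy)
    have := mul_le_mul_of_nonneg_left (hqm y) ha0.le
    nlinarith [sq_nonneg ‖D y‖]
  -- `D` is small at some point of `(x - 1, x)`, by the mean value theorem for the quadratic form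
  obtain ⟨ξ, ⟨hξ1, hξ2⟩, hξ⟩ := exists_hasDerivAt_eq_slope (fun y => Q (D y) (D y))
    (fun x => 2 * Q (D x) (D' x)) (by linarith : x - 1 < x)
    (fun y hy => (hq y (hy.2.trans hx)).continuousAt.continuousWithinAt)
    (fun y hy => hq y (hy.2.le.trans hx))
  have hξx : ξ ≤ x₀ := hξ2.le.trans hx
  have hξD : ‖D ξ‖ ≤ Real.sqrt k₁ * (‖D x₀‖ + B) * Real.exp (a / 2 * (x - x₀)) := by
    have h1 := hq' ξ hξx
    have h2 := (abs_le.1 (hqexp x hx)).2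
    have h3 := (abs_le.1 (hqexp (x - 1) (by linarith))).1
    have h4 : Real.exp (a * (x - 1 - x₀)) ≤ Real.exp (a * (x - x₀)) := by
      apply Real.exp_le_exp.2; nlinarith
    have h5 : Real.exp (2 * β * (ξ - x₀)) ≤ Real.exp (a * (x - x₀)) := by
      apply Real.exp_le_exp.2
      nlinarith [mul_nonneg (sub_nonneg.2 hx) (by linarith : (0:ℝ) ≤ β - a)]
    have h6 := hqm x₀
    set ex := Real.exp (a * (x - x₀)) with hex
    have hex0 : 0 < ex := Real.exp_pos _
    have hN := norm_nonneg (D x₀)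
    have h7 : c * ‖D ξ‖ ^ 2 ≤ (2 * m * ‖D x₀‖ ^ 2 + (2 / β + 1) * P) * ex := by
      have h8 : (|Q (D x₀) (D x₀)| + P / β) * Real.exp (a * (x - 1 - x₀))
          ≤ (|Q (D x₀) (D x₀)| + P / β) * ex := by gcongr
      have h9 : |Q (D x₀) (D x₀)| * ex ≤ m * ‖D x₀‖ ^ 2 * ex := by gcongr
      have h10 : P * Real.exp (2 * β * (ξ - x₀)) ≤ P * ex := by gcongr
      simp only [sub_sub_cancel, div_one] at hξ
      have h11 : (2 / β + 1) * P = 2 * (P / β) + P := by ring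
      rw [h11]
      linarith
    have h8 : ‖D ξ‖ ^ 2 ≤ k₁ * (‖D x₀‖ + B) ^ 2 * ex := by
      rw [hk₁, div_mul_eq_mul_div, div_mul_eq_mul_div, le_div_iff₀ hc, mul_comm]
      refine h7.trans ?_
      gcongr
      have e1 : ‖D x₀‖ ^ 2 ≤ (‖D x₀‖ + B) ^ 2 := by gcongr; linarith
      have e2 : B ^ 2 ≤ (‖D x₀‖ + B) ^ 2 := by gcongr; linarith
      rw [hP, add_mul]
      have e3 : (2 / β + 1) * (2 * m ^ 2 / c * B ^ 2)
        ≤ (2 / β + 1) * (2 * m ^ 2 / c) * (‖D x₀‖ + B) ^ 2 := by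
        rw [← mul_assoc]; gcongr
      have e4 : 2 * m * ‖D x₀‖ ^ 2 ≤ 2 * m * (‖D x₀‖ + B) ^ 2 := by gcongr
      linarith
    refine le_of_sq_le_sq ?_ (by positivity)
    rw [mul_pow, mul_pow, Real.sq_sqrt hk₁0.le, ← Real.exp_nat_mul]
    refine h8.trans (le_of_eq ?_)
    rw [hex]; push_cast; ring_nf
  -- Grönwall's inequality carries the bound from `ξ` to `x`
  have hg := norm_le_gronwallBound_of_norm_deriv_right_le (f := D) (f' := D')
    (δ := Real.sqrt k₁ * (‖D x₀‖ + B) * Real.exp (a / 2 * (x - x₀))) (K := K)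
    (ε := B * Real.exp (a / 2 * (x - x₀))) (a := ξ) (b := x)
    (fun y hy => (hD y (hy.2.trans hx)).continuousAt.continuousWithinAt)
    (fun y hy => (hD y (hy.2.le.trans hx)).hasDerivWithinAt) hξD
    (fun y hy => by
      have h1 := hD' y (hy.2.le.trans hx)
      have h2 : ‖D' y‖ ≤ ‖D' y - A (D y)‖ + ‖A (D y)‖ := by
        simpa using norm_add_le (D' y - A (D y)) (A (D y))
      have h3 := A.le_opNorm (D y)
      have h4 : Real.exp (β * (y - x₀)) ≤ Real.exp (a / 2 * (x - x₀)) := by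
        apply Real.exp_le_exp.2
        nlinarith [mul_nonneg (sub_nonneg.2 hx) (by linarith : (0:ℝ) ≤ β - a / 2), hy.2]
      have h5 := mul_le_mul_of_nonneg_left h4 hB
      rw [hK]; linarith) x ⟨hξ2.le, le_rfl⟩
  rw [gronwallBound_of_K_ne_0 hK0.ne'] at hg
  refine hg.trans ?_
  have h1 : Real.exp (K * (x - ξ)) ≤ Real.exp K := by
    apply Real.exp_le_exp.2; nlinarith
  have h2 : 1 ≤ Real.exp K := Real.one_le_exp hK0.le
  set ex := Real.exp (a / 2 * (x - x₀))
  have hex : 0 < ex := Real.exp_pos _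
  calc _ ≤ Real.sqrt k₁ * (‖D x₀‖ + B) * ex * Real.exp K
        + (‖D x₀‖ + B) * ex / K * Real.exp K := by
        have e1 : B * ex / K * (Real.exp (K * (x - ξ)) - 1)
            ≤ (‖D x₀‖ + B) * ex / K * Real.exp K := by
          have : 0 ≤ Real.exp (K * (x - ξ)) - 1 := by
            linarith [Real.one_le_exp (mul_nonneg hK0.le (sub_nonneg.2 hξ2.le))]
          gcongr
          · linarith [norm_nonneg (D x₀)]
          · linarith
        have e2 : Real.sqrt k₁ * (‖D x₀‖ + B) * ex * Real.exp (K * (x - ξ))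
            ≤ Real.sqrt k₁ * (‖D x₀‖ + B) * ex * Real.exp K := by gcongr
        exact add_le_add e2 e1
    _ = _ := by ring

end

section
variable {E F : Type*} [NormedAddCommGroup E] [NormedSpace ℝ E] [NormedAddCommGroup F]
  [NormedSpace ℝ F]

/-- For `Ψ` vanishing on `{0} × ℝ`, the dependence on the parameter is Lipschitz with a constant
proportional to the distance from `0`. -/
theorem exists_norm_sub_le_of_contDiff [FiniteDimensional ℝ E] {Ψ : E × ℝ → F}
    (hΨ : ContDiff ℝ 2 Ψ) (h0 : ∀ ε, Ψ (0, ε) = 0) (R : ℝ) :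
    ∃ C > 0, ∀ (w w' : E) (ε ε' : ℝ), ‖w‖ ≤ R → ‖w'‖ ≤ R → |ε| ≤ R → |ε'| ≤ R →
      ‖Ψ (w, ε) - Ψ (w', ε')‖ ≤ C * (‖w - w'‖ + |ε - ε'| * ‖w'‖) := by
  have hS : IsCompact (Metric.closedBall (0 : E × ℝ) R) := isCompact_closedBall _ _
  have hmem : ∀ (w : E) (ε : ℝ), ‖w‖ ≤ R → |ε| ≤ R → (w, ε) ∈ Metric.closedBall (0 : E × ℝ) R :=
    fun w ε hw hε => by simpa [Prod.norm_def] using ⟨hw, hε⟩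
  have hΨ' : ContDiff ℝ 1 (fderiv ℝ Ψ) := hΨ.fderiv_right (by norm_num)
  obtain ⟨C₁, hC₁⟩ := hS.exists_bound_of_continuousOn hΨ'.continuous.continuousOn
  obtain ⟨C₂, hC₂⟩ := hS.exists_bound_of_continuousOn
    (hΨ'.continuous_fderiv one_ne_zero).continuousOn
  refine ⟨|C₁| + |C₂| + 1, by positivity, fun w w' ε ε' hw hw' hε hε' => ?_⟩
  have hR : 0 ≤ R := (norm_nonneg w).trans hw
  have h1 : ‖Ψ (w, ε) - Ψ (w', ε)‖ ≤ |C₁| * ‖w - w'‖ := by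
    have := (convex_closedBall (0 : E × ℝ) R).norm_image_sub_le_of_norm_fderiv_le
      (fun p _ => (hΨ.differentiable two_ne_zero) p) hC₁ (hmem w' ε hw' hε) (hmem w ε hw hε)
    refine this.trans ?_
    rw [Prod.mk_sub_mk, sub_self, Prod.norm_mk, norm_zero, max_eq_left (norm_nonneg _)]
    gcongr
    exact le_abs_self _
  have h2 : ‖Ψ (w', ε) - Ψ (w', ε')‖ ≤ |C₂| * (|ε - ε'| * ‖w'‖) := by
    have hd : ∀ (a : ℝ) (v : E), HasFDerivAt (fun v => Ψ (v, a))
        ((fderiv ℝ Ψ (v, a)).comp (ContinuousLinearMap.inl ℝ E ℝ)) v := fun a v =>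
      HasFDerivAt.comp v ((hΨ.differentiable two_ne_zero) (v, a)).hasFDerivAt
        (hasFDerivAt_prodMk_left v a)
    have := (convex_closedBall (0 : E) R).norm_image_sub_le_of_norm_hasFDerivWithin_le
      (f := fun v => Ψ (v, ε) - Ψ (v, ε')) (C := |C₂| * |ε - ε'|)
      (fun v _ => ((hd ε v).sub (hd ε' v)).hasFDerivWithinAt) (fun v hv => by
        rw [← ContinuousLinearMap.sub_comp]
        refine (ContinuousLinearMap.opNorm_comp_le _ _).trans ?_
        have hv' : ‖v‖ ≤ R := by simpa using hv
        have h3 := (convex_closedBall (0 : E × ℝ) R).norm_image_sub_le_of_norm_fderiv_le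
          (fun p _ => (hΨ'.differentiable one_ne_zero) p) hC₂ (hmem v ε' hv' hε') (hmem v ε hv' hε)
        rw [Prod.mk_sub_mk, sub_self, Prod.norm_mk, norm_zero, max_eq_right (norm_nonneg _)] at h3
        have h4 := ContinuousLinearMap.norm_inl_le_one ℝ E ℝ
        have h5 : C₂ * ‖ε - ε'‖ ≤ |C₂| * |ε - ε'| := by
          rw [Real.norm_eq_abs]; gcongr; exact le_abs_self _
        calc _ ≤ (|C₂| * |ε - ε'|) * 1 := mul_le_mul (h3.trans h5) h4 (norm_nonneg _) (by positivity)
          _ = _ := mul_one _)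
      (by simpa using hR : (0 : E) ∈ Metric.closedBall 0 R) (by simpa using hw' : w' ∈ _)
    simpa [h0, mul_assoc] using this
  calc _ ≤ ‖Ψ (w, ε) - Ψ (w', ε)‖ + ‖Ψ (w', ε) - Ψ (w', ε')‖ := norm_sub_le_norm_sub_add_norm_sub ..
    _ ≤ _ := by
      have := norm_nonneg (w - w')
      have : 0 ≤ |ε - ε'| * ‖w'‖ := by positivity
      have := abs_nonneg C₁
      have := abs_nonneg C₂
      nlinarith

theorem exists_pos_le_quadratic_form [FiniteDimensional ℝ E] (Q : E →L[ℝ] E →L[ℝ] ℝ)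
    (A : E →L[ℝ] E) (h : ∀ v, v ≠ 0 → 0 < Q v (A v)) :
    ∃ c > 0, ∀ v, c * ‖v‖ ^ 2 ≤ Q v (A v) := by
  rcases subsingleton_or_nontrivial E with hE | hE
  · exact ⟨1, one_pos, fun v => by simp [Subsingleton.elim v 0]⟩
  obtain ⟨v₀, hv₀, hmin⟩ := (isCompact_sphere (0 : E) 1).exists_isMinOn
    (NormedSpace.sphere_nonempty.2 zero_le_one)
    (f := fun v => Q v (A v)) (by fun_prop)
  have hv₀' : v₀ ≠ 0 := by rintro rfl; simp at hv₀
  refine ⟨Q v₀ (A v₀), h v₀ hv₀', fun v => ?_⟩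
  rcases eq_or_ne v 0 with rfl | hv
  · simp
  have hn : ‖v‖ ≠ 0 := norm_ne_zero_iff.2 hv
  have h1 : Q v₀ (A v₀) ≤ Q (‖v‖⁻¹ • v) (A (‖v‖⁻¹ • v)) :=
    hmin (by simp [norm_smul, hn])
  simp only [map_smul, smul_apply, smul_eq_mul] at h1
  calc _ ≤ ‖v‖⁻¹ * (‖v‖⁻¹ * Q v (A v)) * ‖v‖ ^ 2 := by gcongr
    _ = _ := by field_simp

/-- Exponential decay at `-∞`, near a parameter `ε₀`, of a family of orbits of `w' = Φ (w, ε)`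
converging to the equilibrium `0`, together with the decay of the differences of orbits for two
parameters. The differences satisfy the linearized equation up to a forcing proportional to
`|ε - ε'| ‖W ε'‖`, which decays by the estimate for a single orbit. -/
theorem eventually_exp_decay [FiniteDimensional ℝ E] {Φ : E × ℝ → E} {ε₀ : ℝ}
    (hΦ : ContDiff ℝ 2 Φ) (h0 : ∀ ε, Φ (0, ε) = 0)
    (Q : E →L[ℝ] E →L[ℝ] ℝ) (hsymm : ∀ v w, Q v w = Q w v)
    (hpos : ∀ v, v ≠ 0 → 0 < Q v (fderiv ℝ Φ (0, ε₀) (v, 0)))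
    {W : ℝ → ℝ → E} (hlim : ∀ ε, Tendsto (W ε) atBot (𝓝 0))
    (hunif : ∀ δ > 0, ∃ L, ∀ᶠ ε in 𝓝 ε₀, ∀ x ≤ L, ‖W ε x‖ ≤ δ)
    (hode : ∃ L, ∀ᶠ ε in 𝓝 ε₀, ∀ x ≤ L, HasDerivAt (W ε) (Φ (W ε x, ε)) x)
    (hW : ∀ x, ContDiffAt ℝ 1 (fun ε => W ε x) ε₀) :
    ∃ η > 0, ∃ L, ∃ C > 0, ∃ N ∈ 𝓝 ε₀, ∀ ε ∈ N, ∀ ε' ∈ N, ∀ x ≤ L,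
      ‖W ε x‖ ≤ C * Real.exp (η * x) ∧
      ‖W ε x - W ε' x‖ ≤ C * |ε - ε'| * Real.exp (η * x) := by
  set A : E →L[ℝ] E := (fderiv ℝ Φ (0, ε₀)).comp (ContinuousLinearMap.inl ℝ E ℝ) with hA
  have hAv : ∀ v, A v = fderiv ℝ Φ (0, ε₀) (v, 0) := fun v => by simp [hA]
  obtain ⟨c, hc, hQ⟩ := exists_pos_le_quadratic_form Q A (fun v hv => by rw [hAv]; exact hpos v hv)
  obtain ⟨η₁, hη₁, δ₁, hδ₁, C₁, hC₁, H₁⟩ :=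
    exists_norm_le_exp_of_quadratic_form Q hsymm A hc one_pos hQ
  obtain ⟨η₂, hη₂, δ₂, hδ₂, C₂, hC₂, H₂⟩ :=
    exists_norm_le_exp_of_quadratic_form Q hsymm A hc hη₁ hQ
  -- `Φ` is close to its linearization near `(0, ε₀)`
  have hstrict : ∀ᶠ p in 𝓝 (((0 : E), ε₀), ((0 : E), ε₀)),
      ‖Φ p.1 - Φ p.2 - fderiv ℝ Φ (0, ε₀) (p.1 - p.2)‖ ≤ min δ₁ δ₂ * ‖p.1 - p.2‖ :=
    ((hΦ.contDiffAt.hasStrictFDerivAt two_ne_zero).isLittleO.def (lt_min hδ₁ hδ₂))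
  rw [nhds_prod_eq, eventually_prod_self_iff'] at hstrict
  obtain ⟨S, hS, hS'⟩ := hstrict
  obtain ⟨ρ, hρ, hρS⟩ := Metric.mem_nhds_iff.1 hS
  have hlin : ∀ w w' : E, ∀ ε, ‖w‖ < ρ → ‖w'‖ < ρ → |ε - ε₀| < ρ →
      ‖Φ (w, ε) - Φ (w', ε) - A (w - w')‖ ≤ min δ₁ δ₂ * ‖w - w'‖ := by
    intro w w' ε hw hw' hε
    have hm : ∀ v : E, ‖v‖ < ρ → (v, ε) ∈ S := fun v hv => hρS (by
      rw [mem_ball_iff_norm, Prod.mk_sub_mk, sub_zero, Prod.norm_mk]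
      exact max_lt hv hε)
    have := hS' (w, ε) (hm w hw) (w', ε) (hm w' hw')
    rw [Prod.mk_sub_mk, sub_self, Prod.norm_mk, norm_zero, max_eq_left (norm_nonneg _)] at this
    rwa [hAv]
  set R : ℝ := |ε₀| + 1 with hR
  obtain ⟨C₃, hC₃, H₃⟩ := exists_norm_sub_le_of_contDiff hΦ h0 R
  set r : ℝ := min (ρ / 2) 1 with hr
  have hr0 : 0 < r := lt_min (by positivity) one_pos
  have hrρ : r < ρ := (min_le_left _ _).trans_lt (by linarith)
  have hrR : r ≤ R := (min_le_right _ _).trans (by rw [hR]; linarith [abs_nonneg ε₀])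
  obtain ⟨L₁, hL₁⟩ := hunif r hr0
  obtain ⟨L₂, hL₂⟩ := hode
  set x₀ := min L₁ L₂ with hx₀
  obtain ⟨K, T, hT, hK⟩ := (hW x₀).exists_lipschitzOnWith
  have hev : ∀ᶠ ε in 𝓝 ε₀, (∀ x ≤ x₀, ‖W ε x‖ ≤ r) ∧
      (∀ x ≤ x₀, HasDerivAt (W ε) (Φ (W ε x, ε)) x) ∧ ε ∈ T ∧ |ε - ε₀| < ρ ∧ |ε| ≤ R := by
    filter_upwards [hL₁, hL₂, hT, Metric.ball_mem_nhds ε₀ hρ, Metric.ball_mem_nhds ε₀ one_pos]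
      with ε h1 h2 h3 h4 h5
    refine ⟨fun x hx => h1 x (hx.trans (min_le_left _ _)),
      fun x hx => h2 x (hx.trans (min_le_right _ _)), h3, by simpa [Real.dist_eq] using h4, ?_⟩
    have : |ε - ε₀| < 1 := by simpa [Real.dist_eq] using h5
    have := abs_sub_abs_le_abs_sub ε ε₀
    linarith
  set B₁ : ℝ := C₃ * (C₁ * r) with hB₁
  have hB₁0 : 0 < B₁ := by positivity
  set η := min η₁ η₂ with hη
  have hexp : ∀ η', η ≤ η' → ∀ x ≤ x₀, Real.exp (η' * (x - x₀)) ≤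
      Real.exp (-(η * x₀)) * Real.exp (η * x) := by
    intro η' h x hx
    rw [← Real.exp_add]
    apply Real.exp_le_exp.2
    nlinarith
  set k := Real.exp (-(η * x₀)) with hk
  have hk0 : 0 < k := Real.exp_pos _
  refine ⟨η, lt_min hη₁ hη₂, x₀, C₁ * r * k + C₂ * (K + B₁) * k, by positivity, _, hev, ?_⟩
  -- the decay of the orbit itself
  have hdecay : ∀ ε, (∀ x ≤ x₀, ‖W ε x‖ ≤ r) → (∀ x ≤ x₀, HasDerivAt (W ε) (Φ (W ε x, ε)) x) →
      |ε - ε₀| < ρ → ∀ x ≤ x₀, ‖W ε x‖ ≤ C₁ * r * Real.exp (η₁ * (x - x₀)) := by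
    intro ε h1 h2 h3 x hx
    have := H₁ x₀ 0 (W ε) _ le_rfl h2 (fun y hy => by
      have := hlin (W ε y) 0 ε ((h1 y hy).trans_lt hrρ) (by simpa using hρ) h3
      rw [h0, sub_zero, sub_zero] at this
      rw [zero_mul, add_zero]
      refine this.trans ?_
      gcongr
      exact min_le_left _ _) (hlim ε) x hx
    rw [add_zero] at this
    refine this.trans ?_
    gcongr
    exact h1 x₀ le_rfl
  rintro ε ⟨a1, a2, a3, a4, a5⟩ ε' ⟨b1, b2, b3, b4, b5⟩ x hx
  have hex := Real.exp_pos (η * x)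
  constructor
  · calc _ ≤ C₁ * r * Real.exp (η₁ * (x - x₀)) := hdecay ε a1 a2 a4 x hx
      _ ≤ C₁ * r * (k * Real.exp (η * x)) := by
        gcongr; exact hexp _ (min_le_left _ _) x hx
      _ ≤ _ := by
        have : 0 ≤ C₂ * (K + B₁) * k * Real.exp (η * x) := by positivity
        linarith
  · have := H₂ x₀ (B₁ * |ε - ε'|) (fun y => W ε y - W ε' y) _ (by positivity)
      (fun y hy => (a2 y hy).sub (b2 y hy)) (fun y hy => by
        have e1 := hlin (W ε y) (W ε' y) ε ((a1 y hy).trans_lt hrρ) ((b1 y hy).trans_lt hrρ) a4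
        have e2 := H₃ (W ε' y) (W ε' y) ε ε' ((b1 y hy).trans hrR) ((b1 y hy).trans hrR) a5 b5
        rw [sub_self, norm_zero, zero_add] at e2
        have e3 := hdecay ε' b1 b2 b4 y hy
        have e4 : C₃ * (|ε - ε'| * ‖W ε' y‖) ≤ B₁ * |ε - ε'| * Real.exp (η₁ * (y - x₀)) := by
          calc _ ≤ C₃ * (|ε - ε'| * (C₁ * r * Real.exp (η₁ * (y - x₀)))) := by gcongr
            _ = _ := by rw [hB₁]; ring
        have e5 : min δ₁ δ₂ * ‖W ε y - W ε' y‖ ≤ δ₂ * ‖W ε y - W ε' y‖ := by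
          gcongr; exact min_le_right _ _
        calc ‖Φ (W ε y, ε) - Φ (W ε' y, ε') - A (W ε y - W ε' y)‖
            = ‖(Φ (W ε y, ε) - Φ (W ε' y, ε) - A (W ε y - W ε' y))
              + (Φ (W ε' y, ε) - Φ (W ε' y, ε'))‖ := by congr 1; abel
          _ ≤ _ := (norm_add_le _ _).trans (add_le_add (e1.trans e5) (e2.trans e4)))
      (by simpa using (hlim ε).sub (hlim ε')) x hx
    have hLip : ‖W ε x₀ - W ε' x₀‖ ≤ K * |ε - ε'| := by
      simpa [Real.norm_eq_abs] using hK.norm_sub_le a3 b3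
    calc _ ≤ C₂ * (‖W ε x₀ - W ε' x₀‖ + B₁ * |ε - ε'|) * Real.exp (η₂ * (x - x₀)) := this
      _ ≤ C₂ * (K * |ε - ε'| + B₁ * |ε - ε'|) * (k * Real.exp (η * x)) := by
        gcongr; exact hexp _ (min_le_right _ _) x hx
      _ = C₂ * (K + B₁) * k * (|ε - ε'| * Real.exp (η * x)) := by ring
      _ ≤ (C₁ * r * k + C₂ * (K + B₁) * k) * (|ε - ε'| * Real.exp (η * x)) := by
        gcongr
        have : 0 ≤ C₁ * r * k := by positivity
        linarith
      _ = _ := by ring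

end

/-! ### Derivatives along a flow, and regularity in a parameter -/

section
variable {E F G : Type*} [NormedAddCommGroup E] [NormedSpace ℝ E] [NormedAddCommGroup F]
  [NormedSpace ℝ F] [NormedAddCommGroup G] [NormedSpace ℝ G]

/-- The derivative of the observable `Ψ` along the flow of `w' = Φ (w, ε)`. -/
noncomputable def flowDeriv (Φ : E × ℝ → E) (Ψ : E × ℝ → F) : E × ℝ → F :=
  fun p => fderiv ℝ Ψ p (Φ p, 0)

theorem contDiff_flowDeriv_iterate {Φ : E × ℝ → E} {Ψ : E × ℝ → F} (hΦ : ContDiff ℝ ∞ Φ)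
    (hΨ : ContDiff ℝ ∞ Ψ) (k : ℕ) : ContDiff ℝ ∞ ((flowDeriv Φ)^[k] Ψ) := by
  induction k with
  | zero => exact hΨ
  | succ k ih =>
    rw [Function.iterate_succ_apply']
    exact (ih.fderiv_right (by norm_cast)).clm_apply (hΦ.prodMk contDiff_const)

theorem flowDeriv_iterate_zero {Φ : E × ℝ → E} {Ψ : E × ℝ → F} (hΦ : ∀ ε, Φ (0, ε) = 0)
    (hΨ : ∀ ε, Ψ (0, ε) = 0) (k : ℕ) (ε : ℝ) : (flowDeriv Φ)^[k] Ψ (0, ε) = 0 := by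
  cases k with
  | zero => exact hΨ ε
  | succ k =>
    rw [Function.iterate_succ_apply', flowDeriv, hΦ, Prod.mk_zero_zero, map_zero]

/-- Along an orbit of `w' = Φ (w, ε)`, every derivative in `x` of an observable is again an
observable, smooth in `(w, ε)`. -/
theorem iteratedDeriv_eq_flowDeriv_iterate {Φ : E × ℝ → E} {Ψ : E × ℝ → F}
    (hΦ : ContDiff ℝ ∞ Φ) (hΨ : ContDiff ℝ ∞ Ψ) {w : ℝ → E} {ε : ℝ} {S : Set ℝ} (hS : IsOpen S)
    (hw : ∀ x ∈ S, HasDerivAt w (Φ (w x, ε)) x) {f : ℝ → F} (hf : ∀ x ∈ S, f x = Ψ (w x, ε))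
    (k : ℕ) : ∀ x ∈ S, iteratedDeriv k f x = (flowDeriv Φ)^[k] Ψ (w x, ε) := by
  induction k with
  | zero => simpa using hf
  | succ k ih =>
    intro x hx
    have h1 : iteratedDeriv k f =ᶠ[𝓝 x] fun y => (flowDeriv Φ)^[k] Ψ (w y, ε) := by
      filter_upwards [hS.mem_nhds hx] with y hy using ih y hy
    rw [iteratedDeriv_succ, h1.deriv_eq, Function.iterate_succ_apply']
    have h2 := ((contDiff_flowDeriv_iterate hΦ hΨ k).differentiable (by simp)
      (w x, ε)).hasFDerivAt
    exact (h2.comp_hasDerivAt x ((hw x hx).prodMk (hasDerivAt_const x ε))).deriv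

/-- The function `f` of the parameter `ε` and of `x` is continuous together with its derivative
with respect to the parameter. -/
structure IsC1Param (f : ℝ → ℝ → F) : Prop where
  continuous : Continuous fun p : ℝ × ℝ => f p.1 p.2
  differentiable : ∀ x, Differentiable ℝ fun ε => f ε x
  continuous_deriv : Continuous fun p : ℝ × ℝ => deriv (fun ε => f ε p.2) p.1

namespace IsC1Param

theorem of_hasDerivAt {f f' : ℝ → ℝ → F} (hf : Continuous fun p : ℝ × ℝ => f p.1 p.2)
    (hf' : Continuous fun p : ℝ × ℝ => f' p.1 p.2)
    (h : ∀ ε x, HasDerivAt (fun e => f e x) (f' ε x) ε) : IsC1Param f where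
  continuous := hf
  differentiable x ε := (h ε x).differentiableAt
  continuous_deriv := by
    have : (fun p : ℝ × ℝ => deriv (fun ε => f ε p.2) p.1) = fun p => f' p.1 p.2 :=
      funext fun p => (h p.1 p.2).deriv
    rwa [this]

theorem hasDerivAt {f : ℝ → ℝ → F} (hf : IsC1Param f) (ε x : ℝ) :
    HasDerivAt (fun e => f e x) (deriv (fun e => f e x) ε) ε :=
  (hf.differentiable x ε).hasDerivAt

theorem contDiff {f : ℝ → ℝ → F} (hf : IsC1Param f) (x : ℝ) :
    ContDiff ℝ 1 fun ε => f ε x :=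
  contDiff_one_iff_deriv.2 ⟨hf.differentiable x,
    hf.continuous_deriv.comp (continuous_id.prodMk continuous_const)⟩

theorem comp {f : ℝ → ℝ → F} (hf : IsC1Param f) {Θ : F × ℝ → G} (hΘ : ContDiff ℝ 1 Θ) :
    IsC1Param fun ε x => Θ (f ε x, ε) := by
  refine of_hasDerivAt
    (f' := fun ε x => fderiv ℝ Θ (f ε x, ε) (deriv (fun e => f e x) ε, 1)) ?_ ?_ ?_
  · exact hΘ.continuous.comp (hf.continuous.prodMk continuous_fst)
  · exact ((hΘ.continuous_fderiv one_ne_zero).comp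
      (hf.continuous.prodMk continuous_fst)).clm_apply
      (hf.continuous_deriv.prodMk continuous_const)
  · intro ε x
    exact HasFDerivAt.comp_hasDerivAt (f := fun e => (f e x, e)) ε
      ((hΘ.differentiable one_ne_zero) (f ε x, ε)).hasFDerivAt
      ((hf.hasDerivAt ε x).prodMk (hasDerivAt_id ε))

theorem prodMk {f : ℝ → ℝ → F} {g : ℝ → ℝ → G} (hf : IsC1Param f) (hg : IsC1Param g) :
    IsC1Param fun ε x => (f ε x, g ε x) :=
  of_hasDerivAt (hf.continuous.prodMk hg.continuous)
    (hf.continuous_deriv.prodMk hg.continuous_deriv)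
    fun ε x => (hf.hasDerivAt ε x).prodMk (hg.hasDerivAt ε x)

theorem of_contDiff {a : ℝ → F} (ha : ContDiff ℝ 1 a) : IsC1Param fun ε _ => a ε :=
  of_hasDerivAt (f' := fun ε _ => deriv a ε) (ha.continuous.comp continuous_fst)
    ((ha.continuous_deriv le_rfl).comp continuous_fst)
    fun ε _ => (ha.differentiable one_ne_zero ε).hasDerivAt

theorem of_boundedContinuousFunction {U : ℝ → (ℝ →ᵇ F)} (hU : ContDiff ℝ 1 U) :
    IsC1Param fun ε x => U ε x := by
  refine of_hasDerivAt (f' := fun ε x => deriv U ε x) ?_ ?_ ?_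
  · exact (hU.continuous.comp continuous_fst).eval continuous_snd
  · exact ((hU.continuous_deriv le_rfl).comp continuous_fst).eval continuous_snd
  · intro ε x
    exact (BoundedContinuousFunction.evalCLM ℝ x).hasFDerivAt.comp_hasDerivAt ε
      (hU.differentiable one_ne_zero ε).hasDerivAt

theorem integral [CompleteSpace F] {f : ℝ → ℝ → F} (hf : IsC1Param f) (L : ℝ) :
    IsC1Param fun ε x => ∫ t in L..x, f ε t := by
  have hcont : ∀ g : ℝ → ℝ → F, (Continuous fun p : ℝ × ℝ => g p.1 p.2) →
      Continuous fun p : ℝ × ℝ => ∫ t in L..p.2, g p.1 t := fun g hg =>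
    intervalIntegral.continuous_parametric_intervalIntegral_of_continuous
      (f := fun (p : ℝ × ℝ) t => g p.1 t)
      (hg.comp ((continuous_fst.comp continuous_fst).prodMk continuous_snd)) continuous_snd
  refine of_hasDerivAt (f' := fun ε x => ∫ t in L..x, deriv (fun e => f e t) ε)
    (hcont f hf.continuous)
    (hcont (fun ε t => deriv (fun e => f e t) ε) hf.continuous_deriv) ?_
  intro ε x
  obtain ⟨C, hC⟩ := ((isCompact_closedBall ε 1).prod (isCompact_uIcc (a := L)
    (b := x))).exists_bound_of_continuousOn hf.continuous_deriv.continuousOn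
  have hsec : ∀ e, Continuous fun t => f e t := fun e =>
    hf.continuous.comp (continuous_const.prodMk continuous_id)
  have hsec' : Continuous fun t => deriv (fun e => f e t) ε :=
    hf.continuous_deriv.comp (continuous_const.prodMk continuous_id)
  refine (intervalIntegral.hasDerivAt_integral_of_dominated_loc_of_deriv_le
    (F := f) (F' := fun e t => deriv (fun e => f e t) e) (bound := fun _ => C)
    (Metric.closedBall_mem_nhds ε one_pos)
    (Eventually.of_forall fun e => (hsec e).aestronglyMeasurable)
    ((hsec ε).intervalIntegrable _ _) hsec'.aestronglyMeasurable ?_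
    (continuous_const.intervalIntegrable _ _) ?_).2
  · exact Eventually.of_forall fun t ht e he => hC (e, t) ⟨he, Set.uIoc_subset_uIcc ht⟩
  · exact Eventually.of_forall fun t _ e _ => hf.hasDerivAt e t

theorem of_local {f : ℝ → ℝ → F}
    (h : ∀ ε₀, ∃ g : ℝ → ℝ → F, IsC1Param g ∧ ∀ᶠ ε in 𝓝 ε₀, ∀ x, f ε x = g ε x) :
    IsC1Param f where
  continuous := continuous_iff_continuousAt.2 fun p => by
    obtain ⟨g, hg, hfg⟩ := h p.1
    refine hg.continuous.continuousAt.congr ?_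
    filter_upwards [(continuous_fst.tendsto p).eventually hfg] with q hq using (hq q.2).symm
  differentiable x ε := by
    obtain ⟨g, hg, hfg⟩ := h ε
    exact (hg.differentiable x ε).congr_of_eventuallyEq (hfg.mono fun e he => he x)
  continuous_deriv := continuous_iff_continuousAt.2 fun p => by
    obtain ⟨g, hg, hfg⟩ := h p.1
    refine hg.continuous_deriv.continuousAt.congr ?_
    filter_upwards [(continuous_fst.tendsto p).eventually hfg.eventually_nhds] with q hq
    exact (EventuallyEq.deriv_eq (hq.mono fun e he => he q.2)).symm

end IsC1Param

/-- The limit along `l` extends to a bounded linear functional on all bounded continuous functions,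
as the limit along an ultrafilter. Hence endstates are as regular in a parameter as the
profiles. -/
theorem exists_continuousLinearMap_eq_of_tendsto [FiniteDimensional ℝ F] (l : Filter ℝ)
    [NeBot l] : ∃ Λ : (ℝ →ᵇ F) →L[ℝ] F, ∀ (f : ℝ →ᵇ F) (a : F), Tendsto f l (𝓝 a) → Λ f = a := by
  have hex : ∀ f : ℝ →ᵇ F, ∃ a, Tendsto f (Ultrafilter.of l) (𝓝 a) := fun f => by
    have hc : IsCompact (Metric.closedBall (0 : F) ‖f‖) :=
      have := FiniteDimensional.proper ℝ F
      isCompact_closedBall _ _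
    obtain ⟨a, -, ha⟩ := hc.ultrafilter_le_nhds ((Ultrafilter.of l).map f) (by
      rw [Ultrafilter.coe_map, le_principal_iff]
      exact mem_map.2 (Eventually.of_forall fun x => by simpa using f.norm_coe_le_norm x))
    exact ⟨a, ha⟩
  choose lim hlim using hex
  refine ⟨LinearMap.mkContinuous
    { toFun := lim
      map_add' := fun f g => tendsto_nhds_unique (hlim (f + g)) ((hlim f).add (hlim g))
      map_smul' := fun c f => tendsto_nhds_unique (hlim (c • f)) ((hlim f).const_smul c) } 1
    (fun (f : ℝ →ᵇ F) => ?_), fun (f : ℝ →ᵇ F) a ha => ?_⟩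
  · rw [one_mul]
    exact le_of_tendsto (hlim f).norm (Eventually.of_forall f.norm_coe_le_norm)
  · exact tendsto_nhds_unique (hlim f) (ha.mono_left (Ultrafilter.of_le l))

end

/-! ### Derivatives of functions with a limit at infinity -/

theorem exists_tendsto_deriv_zero {l : Filter ℝ} (hl : l = atTop ∨ l = atBot) {f f' : ℝ → ℝ}
    (hf : ∀ x, HasDerivAt f (f' x) x) {a : ℝ} (ha : Tendsto f l (𝓝 a)) :
    ∃ ξ : ℝ → ℝ, Tendsto ξ l l ∧ Tendsto (fun x => f' (ξ x)) l (𝓝 0) := by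
  have h : ∀ x : ℝ, ∃ ξ, (x < ξ ∧ ξ < x + 1) ∧ f' ξ = f (x + 1) - f x := fun x => by
    obtain ⟨ξ, hξ, h⟩ := exists_hasDerivAt_eq_slope f f' (by linarith : x < x + 1)
      (fun y _ => (hf y).continuousAt.continuousWithinAt) (fun y _ => hf y)
    exact ⟨ξ, hξ, by simpa using h⟩
  choose ξ hξ h using h
  have h1 : Tendsto (fun x : ℝ => x + 1) l l := by
    rcases hl with rfl | rfl
    · exact tendsto_atTop_add_const_right _ _ tendsto_id
    · exact tendsto_atBot_add_const_right _ _ tendsto_id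
  refine ⟨ξ, ?_, ?_⟩
  · rcases hl with rfl | rfl
    · exact tendsto_atTop_mono (fun x => (hξ x).1.le) tendsto_id
    · exact tendsto_atBot_mono (fun x => (hξ x).2.le) h1
  · simp only [h]
    simpa using (ha.comp h1).sub ha

theorem eq_zero_of_tendsto_deriv {l : Filter ℝ} (hl : l = atTop ∨ l = atBot) {f f' : ℝ → ℝ}
    (hf : ∀ x, HasDerivAt f (f' x) x) {a b : ℝ} (ha : Tendsto f l (𝓝 a))
    (hb : Tendsto f' l (𝓝 b)) : b = 0 := by
  obtain ⟨ξ, hξ, h⟩ := exists_tendsto_deriv_zero hl hf ha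
  have : NeBot l := by rcases hl with rfl | rfl <;> infer_instance
  exact tendsto_nhds_unique (hb.comp hξ) h

/-- For a monotone function, convergence along a sequence of points suffices. -/
theorem tendsto_of_monotone_of_tendsto_comp {l : Filter ℝ} (hl : l = atTop ∨ l = atBot) {w : ℝ → ℝ}
    (hw : Monotone w) {ξ : ℝ → ℝ} (hξ : Tendsto ξ l l) {b : ℝ}
    (h : Tendsto (fun x => w (ξ x)) l (𝓝 b)) : Tendsto w l (𝓝 b) := by
  rcases hl with rfl | rfl
  · rcases tendsto_atTop_of_monotone hw with h' | ⟨b', h'⟩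
    · exact absurd h (not_tendsto_nhds_of_tendsto_atTop (h'.comp hξ) b)
    · rwa [tendsto_nhds_unique h (h'.comp hξ)]
  · have ha : Antitone fun x => w (-x) := fun x y hxy => hw (neg_le_neg hxy)
    rcases tendsto_atTop_of_antitone ha with h' | ⟨b', h'⟩
    · have h2 : Tendsto w atBot atBot := by
        simpa [Function.comp_def] using h'.comp tendsto_neg_atBot_atTop
      exact absurd h (not_tendsto_nhds_of_tendsto_atBot (h2.comp hξ) b)
    · have h2 : Tendsto w atBot (𝓝 b') := by
        simpa [Function.comp_def] using h'.comp tendsto_neg_atBot_atTop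
      rwa [tendsto_nhds_unique h (h2.comp hξ)]

/-! ### The profile equation in polynomial form -/

/-- The flux `d τ⁻² z' + s z` of the reactant, diffusive and convective. Its derivative is the
reaction rate. -/
noncomputable def reactantFlux (M : Model) (U : ℝ → State) (x : ℝ) : ℝ :=
  M.d / U x 0 ^ 2 * deriv U x 3 + M.s * U x 3

/-- Velocity, internal energy, mass fraction and flux of the reactant along a profile, relative
to their values at the endstate `B`. -/
noncomputable def waveCoord (M : Model) (B : State) (U : ℝ → State) (x : ℝ) : ℝ × ℝ × ℝ × ℝ :=
  (U x 1 - B 1, M.internalEnergy (U x) - M.internalEnergy B, U x 3 - B 3,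
    reactantFlux M U x - M.s * B 3)

/-- The travelling-wave field in the coordinates `waveCoord`. It is polynomial up to the reaction
rate `ρ`, which is passed separately. -/
noncomputable def profileField (M : Model) (B : State) (ρ : ℝ) (W : ℝ × ℝ × ℝ × ℝ) :
    ℝ × ℝ × ℝ × ℝ :=
  ((M.Γ * W.2.1 - B 0 * M.s * W.1 + M.pressure B / M.s * W.1 + W.1 ^ 2) / M.ν,
    M.c * (B 0 - W.1 / M.s) / M.κ
      * (M.s * W.1 ^ 2 / 2 + M.pressure B * W.1 - M.s * W.2.1 - M.q * W.2.2.2),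
    (B 0 - W.1 / M.s) ^ 2 / M.d * (W.2.2.2 - M.s * W.2.2.1),
    ρ)

theorem Model.flux_eq (M : Model) (V : State) :
    M.flux V = ![-V 1 - M.s * V 0, M.pressure V - M.s * V 1, M.pressure V * V 1 - M.s * V 2,
      -(M.s * V 3)] := by
  ext i
  fin_cases i <;> simp [Model.flux, -Matrix.cons_sub, -Matrix.sub_cons]

theorem Model.viscosity_mulVec_eq (M : Model) (V D : State) :
    M.viscosity V *ᵥ D = ![0, M.ν / V 0 * D 1,
      (M.ν - M.κ / M.c) * V 1 / V 0 * D 1 + M.κ / (M.c * V 0) * D 2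
        + (M.q * M.d / V 0 ^ 2 - M.q * M.κ / (M.c * V 0)) * D 3, M.d / V 0 ^ 2 * D 3] := by
  ext i
  fin_cases i <;> simp [Model.viscosity, Matrix.mulVec, dotProduct, Fin.sum_univ_four]

namespace IsStrongDetonation

variable {Ti : ℝ} {M : Model} {U : ℝ → State} {Um Up : State}

theorem hasDerivAt (h : IsStrongDetonation Ti M U Um Up) (x : ℝ) :
    HasDerivAt U (deriv U x) x :=
  (h.smooth.differentiable (by simp) x).hasDerivAt

theorem hasDerivAt_apply (h : IsStrongDetonation Ti M U Um Up) (i : Fin 4) (x : ℝ) :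
    HasDerivAt (fun y => U y i) (deriv U x i) x :=
  hasDerivAt_pi.1 (h.hasDerivAt x) i

/-- The stationary equations in conservation form. -/
theorem hasDerivAt_flux_sub (h : IsStrongDetonation Ti M U Um Up) (x : ℝ) :
    HasDerivAt (fun y => M.flux (U y) - M.viscosity (U y) *ᵥ deriv U y) (M.source (U x)) x := by
  have hτ : ∀ y, U y 0 ≠ 0 := fun y => (h.physical y).volume_pos.ne'
  have hU : ∀ i, Differentiable ℝ fun y => U y i := fun i y =>
    (h.hasDerivAt_apply i y).differentiableAt
  have hD : Differentiable ℝ (deriv U) :=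
    ((contDiff_infty_iff_deriv.1 h.smooth).2).differentiable (by simp)
  have hD' : ∀ i, Differentiable ℝ fun y => deriv U y i := fun i => differentiable_pi.1 hD i
  have hf : Differentiable ℝ fun y => M.flux (U y) := by
    refine differentiable_pi.2 fun i => ?_
    fin_cases i <;>
      simp only [Model.flux, Model.pressure, Model.internalEnergy, Fin.zero_eta, Fin.mk_one,
        Fin.reduceFinMk, Pi.sub_apply, Pi.smul_apply, smul_eq_mul, Matrix.cons_val] <;>
      fun_prop (disch := exact hτ _)
  have hv : Differentiable ℝ fun y => M.viscosity (U y) *ᵥ deriv U y := by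
    refine differentiable_pi.2 fun i => ?_
    fin_cases i <;>
      simp only [Model.viscosity, Fin.zero_eta, Fin.mk_one, Fin.reduceFinMk, Matrix.mulVec,
        dotProduct, Fin.sum_univ_four, Matrix.of_apply, Matrix.cons_val, div_mul_eq_div_div] <;>
      fun_prop (disch := first | exact hτ | exact fun y => pow_ne_zero _ (hτ y))
  have := (hf x).hasDerivAt.sub (hv x).hasDerivAt
  rwa [h.stationary x, add_sub_cancel_left] at this

theorem hasDerivAt_reactantFlux (h : IsStrongDetonation Ti M U Um Up) (x : ℝ) :
    HasDerivAt (reactantFlux M U) (M.k * M.φ (M.temperature (U x)) * U x 3) x := by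
  have h3 := (hasDerivAt_pi.1 (h.hasDerivAt_flux_sub x) 3).neg
  have hS : -M.source (U x) 3 = M.k * M.φ (M.temperature (U x)) * U x 3 := by
    simp [Model.source]
  rw [hS] at h3
  refine h3.congr_of_eventuallyEq (Eventually.of_forall fun y => ?_)
  simp [Model.flux_eq, Model.viscosity_mulVec_eq, reactantFlux]

theorem monotone_reactantFlux (h : IsStrongDetonation Ti M U Um Up) :
    Monotone (reactantFlux M U) := by
  refine monotone_of_deriv_nonneg (fun x => (h.hasDerivAt_reactantFlux x).differentiableAt)
    fun x => ?_
  rw [(h.hasDerivAt_reactantFlux x).deriv]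
  have hφ : 0 ≤ M.φ (M.temperature (U x)) := by
    rcases le_or_gt (M.temperature (U x)) Ti with hT | hT
    · exact (h.ignition.eq_zero _ hT).ge
    · exact (h.ignition.pos _ hT).le
  exact mul_nonneg (mul_nonneg h.rate_pos.le hφ) (h.physical x).fraction_nonneg

theorem deriv_fraction (h : IsStrongDetonation Ti M U Um Up) (x : ℝ) :
    deriv U x 3 = U x 0 ^ 2 / M.d * (reactantFlux M U x - M.s * U x 3) := by
  have := (h.physical x).volume_pos.ne'
  have := h.diffusion_pos.ne'
  rw [reactantFlux]
  field_simp
  ring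

/-- A component of the flux without source term is constant. -/
theorem flux_sub_apply_eq (h : IsStrongDetonation Ti M U Um Up) {i : Fin 4}
    (hi : ∀ V, M.source V i = 0) (x y : ℝ) :
    (M.flux (U x) - M.viscosity (U x) *ᵥ deriv U x) i
      = (M.flux (U y) - M.viscosity (U y) *ᵥ deriv U y) i := by
  have hd : ∀ x, HasDerivAt (fun y => (M.flux (U y) - M.viscosity (U y) *ᵥ deriv U y) i) 0 x :=
    fun x => by
      have := hasDerivAt_pi.1 (h.hasDerivAt_flux_sub x) i
      rwa [hi] at this
  exact is_const_of_deriv_eq_zero (fun x => (hd x).differentiableAt) (fun x => (hd x).deriv) x y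

section Endstate

variable {l : Filter ℝ} {B : State}

theorem tendsto_apply (hB : Tendsto U l (𝓝 B)) (i : Fin 4) :
    Tendsto (fun x => U x i) l (𝓝 (B i)) :=
  tendsto_pi_nhds.1 hB i

theorem tendsto_internalEnergy (hB : Tendsto U l (𝓝 B)) :
    Tendsto (fun x => M.internalEnergy (U x)) l (𝓝 (M.internalEnergy B)) :=
  ((tendsto_apply hB 2).sub (((tendsto_apply hB 1).pow 2).div_const 2)).sub
    ((tendsto_apply hB 3).const_mul _)

theorem tendsto_pressure (hB : Tendsto U l (𝓝 B)) (hp : B 0 ≠ 0) :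
    Tendsto (fun x => M.pressure (U x)) l (𝓝 (M.pressure B)) :=
  ((tendsto_internalEnergy hB).const_mul _).div (tendsto_apply hB 0) hp

/-- The integrated equation of continuity. -/
theorem volume_eq (h : IsStrongDetonation Ti M U Um Up) [NeBot l] (hB : Tendsto U l (𝓝 B))
    (x : ℝ) : U x 0 = B 0 - (U x 1 - B 1) / M.s := by
  have h1 : ∀ y, U x 1 + M.s * U x 0 = U y 1 + M.s * U y 0 := fun y => by
    have := h.flux_sub_apply_eq (i := 0) (fun V => by simp [Model.source]) x y
    simp [Model.flux_eq, Model.viscosity_mulVec_eq] at this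
    linarith
  have h2 : U x 1 + M.s * U x 0 = B 1 + M.s * B 0 := by
    refine tendsto_nhds_unique (tendsto_const_nhds.congr h1)
      ((tendsto_apply hB 1).add ((tendsto_apply hB 0).const_mul _))
  have := h.speed_pos.ne'
  field_simp
  linarith

/-- The integrated momentum equation. The constant of integration is the value at the endstate,
since `u'` converges, necessarily to `0`. -/
theorem deriv_velocity (h : IsStrongDetonation Ti M U Um Up)
    (hl : l = atTop ∨ l = atBot) (hB : Tendsto U l (𝓝 B)) (hp : 0 < B 0) (x : ℝ) :
    M.ν / U x 0 * deriv U x 1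
      = (M.pressure (U x) - M.s * U x 1) - (M.pressure B - M.s * B 1) := by
  have : NeBot l := by rcases hl with rfl | rfl <;> infer_instance
  have hν := h.viscosity_pos.ne'
  have h1 : ∀ y, M.pressure (U x) - M.s * U x 1 - M.ν / U x 0 * deriv U x 1
      = M.pressure (U y) - M.s * U y 1 - M.ν / U y 0 * deriv U y 1 := fun y => by
    have := h.flux_sub_apply_eq (i := 1) (fun V => by simp [Model.source]) x y
    simpa [Model.flux_eq, Model.viscosity_mulVec_eq] using this
  set n := M.pressure (U x) - M.s * U x 1 - M.ν / U x 0 * deriv U x 1 with hn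
  have h2 : ∀ y, deriv U y 1 = U y 0 / M.ν * (M.pressure (U y) - M.s * U y 1 - n) := fun y => by
    have := (h.physical y).volume_pos.ne'
    rw [h1 y]
    field_simp
    ring
  have h3 := eq_zero_of_tendsto_deriv hl (h.hasDerivAt_apply 1) (tendsto_apply hB 1)
    (((((tendsto_apply hB 0).div_const M.ν).mul (((tendsto_pressure (M := M) hB hp.ne').sub
      ((tendsto_apply hB 1).const_mul M.s)).sub_const n))).congr fun y => (h2 y).symm)
  have h4 : M.pressure B - M.s * B 1 - n = 0 :=
    (mul_eq_zero.1 h3).resolve_left (div_ne_zero hp.ne' hν)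
  linarith

/-- The flux of the reactant converges because it is monotone and converges along the points where
the mean value theorem makes `z'` small. -/
theorem tendsto_reactantFlux (h : IsStrongDetonation Ti M U Um Up)
    (hl : l = atTop ∨ l = atBot) (hB : Tendsto U l (𝓝 B)) (hp : 0 < B 0) :
    Tendsto (reactantFlux M U) l (𝓝 (M.s * B 3)) := by
  obtain ⟨ξ, hξ, h0⟩ := exists_tendsto_deriv_zero hl (h.hasDerivAt_apply 3) (tendsto_apply hB 3)
  refine tendsto_of_monotone_of_tendsto_comp hl h.monotone_reactantFlux hξ ?_
  have := (((tendsto_const_nhds (x := M.d)).div (((tendsto_apply hB 0).comp hξ).pow 2)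
    (pow_ne_zero 2 hp.ne')).mul h0).add (((tendsto_apply hB 3).comp hξ).const_mul M.s)
  simpa [reactantFlux, Function.comp_def] using this

/-- The integrated energy equation. -/
theorem deriv_energy (h : IsStrongDetonation Ti M U Um Up) (hc : M.c ≠ 0)
    (hl : l = atTop ∨ l = atBot) (hB : Tendsto U l (𝓝 B)) (hp : 0 < B 0) (x : ℝ) :
    (M.ν - M.κ / M.c) * U x 1 / U x 0 * deriv U x 1 + M.κ / (M.c * U x 0) * deriv U x 2
        + (M.q * M.d / U x 0 ^ 2 - M.q * M.κ / (M.c * U x 0)) * deriv U x 3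
      = (M.pressure (U x) * U x 1 - M.s * U x 2) - (M.pressure B * B 1 - M.s * B 2) := by
  have : NeBot l := by rcases hl with rfl | rfl <;> infer_instance
  have hκ := h.conduction_pos.ne'
  have hν := h.viscosity_pos.ne'
  set m : ℝ → ℝ := fun y => (M.ν - M.κ / M.c) * U y 1 / U y 0 * deriv U y 1
    + M.κ / (M.c * U y 0) * deriv U y 2
    + (M.q * M.d / U y 0 ^ 2 - M.q * M.κ / (M.c * U y 0)) * deriv U y 3 with hm
  have h1 : ∀ y, M.pressure (U x) * U x 1 - M.s * U x 2 - m x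
      = M.pressure (U y) * U y 1 - M.s * U y 2 - m y := fun y => by
    have := h.flux_sub_apply_eq (i := 2) (fun V => by simp [Model.source]) x y
    simpa [Model.flux_eq, Model.viscosity_mulVec_eq, hm] using this
  set n := M.pressure (U x) * U x 1 - M.s * U x 2 - m x with hn
  have hτ := tendsto_apply hB 0
  have hd1 : Tendsto (fun y => deriv U y 1) l (𝓝 0) := by
    have h2 : ∀ y, U y 0 / M.ν * ((M.pressure (U y) - M.s * U y 1)
        - (M.pressure B - M.s * B 1)) = deriv U y 1 := fun y => by
      have := (h.physical y).volume_pos.ne'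
      rw [← h.deriv_velocity hl hB hp y]
      field_simp
    have h3 := (hτ.div_const M.ν).mul (((tendsto_pressure (M := M) hB hp.ne').sub
      ((tendsto_apply hB 1).const_mul M.s)).sub_const (M.pressure B - M.s * B 1))
    rw [sub_self, mul_zero] at h3
    exact h3.congr h2
  have hd3 : Tendsto (fun y => deriv U y 3) l (𝓝 0) := by
    have h3 := ((hτ.pow 2).div_const M.d).mul ((h.tendsto_reactantFlux hl hB hp).sub
      ((tendsto_apply hB 3).const_mul M.s))
    rw [sub_self, mul_zero] at h3
    exact h3.congr fun y => (h.deriv_fraction y).symm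
  have h2 : ∀ y, deriv U y 2 = M.c * U y 0 / M.κ * (M.pressure (U y) * U y 1 - M.s * U y 2 - n
      - (M.ν - M.κ / M.c) * U y 1 / U y 0 * deriv U y 1
      - (M.q * M.d / U y 0 ^ 2 - M.q * M.κ / (M.c * U y 0)) * deriv U y 3) := fun y => by
    have := (h.physical y).volume_pos.ne'
    rw [h1 y, hm]
    field_simp
    ring
  have hlim := ((hτ.const_mul M.c).div_const M.κ).mul
    ((((((tendsto_pressure (M := M) hB hp.ne').mul (tendsto_apply hB 1)).sub
      ((tendsto_apply hB 2).const_mul M.s)).sub_const n).sub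
      ((((tendsto_apply hB 1).const_mul (M.ν - M.κ / M.c)).div hτ hp.ne').mul hd1)).sub
      ((((tendsto_const_nhds (x := M.q * M.d)).div (hτ.pow 2) (pow_ne_zero 2 hp.ne')).sub
        ((tendsto_const_nhds (x := M.q * M.κ)).div (hτ.const_mul M.c)
          (mul_ne_zero hc hp.ne'))).mul hd3))
  have h3 := eq_zero_of_tendsto_deriv hl (h.hasDerivAt_apply 2) (tendsto_apply hB 2)
    (hlim.congr fun y => (h2 y).symm)
  rw [mul_zero, mul_zero, sub_zero, sub_zero] at h3
  have h4 := (mul_eq_zero.1 h3).resolve_left (div_ne_zero (mul_ne_zero hc hp.ne') hκ)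
  change m x = _
  linarith

/-- The profile solves an ordinary differential equation whose field is polynomial in the
coordinates relative to either endstate. -/
theorem hasDerivAt_waveCoord (h : IsStrongDetonation Ti M U Um Up) (hc : M.c ≠ 0)
    (hl : l = atTop ∨ l = atBot) (hB : Tendsto U l (𝓝 B)) (hp : 0 < B 0) (x : ℝ) :
    HasDerivAt (waveCoord M B U) (profileField M B (M.k * M.φ (M.temperature (U x)) * U x 3)
      (waveCoord M B U x)) x := by
  have : NeBot l := by rcases hl with rfl | rfl <;> infer_instance
  have hκ := h.conduction_pos.ne'
  have hν := h.viscosity_pos.ne'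
  have hd := h.diffusion_pos.ne'
  have hs := h.speed_pos.ne'
  have hτ := (h.physical x).volume_pos.ne'
  have hvol := h.volume_eq hB x
  have h1 := h.deriv_velocity hl hB hp x
  have h2 := h.deriv_energy hc hl hB hp x
  have h3 := h.deriv_fraction x
  have hpx : M.pressure (U x) * U x 0 = M.Γ * M.internalEnergy (U x) := by
    rw [Model.pressure]; field_simp
  have hpB : M.pressure B * B 0 = M.Γ * M.internalEnergy B := by
    have := hp.ne'
    rw [Model.pressure]; field_simp
  have he : HasDerivAt (fun y => M.internalEnergy (U y))
      (deriv U x 2 - U x 1 * deriv U x 1 - M.q * deriv U x 3) x := by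
    refine (((h.hasDerivAt_apply 2 x).sub (((h.hasDerivAt_apply 1 x).pow 2).div_const 2)).sub
      ((h.hasDerivAt_apply 3 x).const_mul M.q)).congr_deriv ?_
    ring
  refine (((h.hasDerivAt_apply 1 x).sub_const (B 1)).prodMk ((he.sub_const _).prodMk
    (((h.hasDerivAt_apply 3 x).sub_const (B 3)).prodMk
      ((h.hasDerivAt_reactantFlux x).sub_const _)))).congr_deriv ?_
  simp only [profileField, waveCoord, Prod.mk.injEq, and_true]
  have hv : U x 1 - B 1 = M.s * (B 0 - U x 0) := by rw [hvol]; field_simp; ring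
  rw [← hvol]
  refine ⟨?_, ?_, ?_⟩
  · have h4 : M.ν * deriv U x 1 = U x 0 * ((M.pressure (U x) - M.s * U x 1)
        - (M.pressure B - M.s * B 1)) := by rw [← h1]; field_simp
    have h5 : M.pressure B / M.s * (U x 1 - B 1) = M.pressure B * (B 0 - U x 0) := by
      rw [hv]; field_simp
    rw [h5, eq_div_iff hν]
    -- the products with `τ` cancel the denominator of the pressure, leaving a polynomial
    linear_combination h4 + hpx - hpB - (U x 1 - B 1) * hv
  · have h4 : M.d / U x 0 ^ 2 * deriv U x 3 = reactantFlux M U x - M.s * U x 3 := by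
      rw [h3]; field_simp
    have h5 : M.κ / (M.c * U x 0) * (deriv U x 2 - U x 1 * deriv U x 1 - M.q * deriv U x 3)
        = M.s * (U x 1 - B 1) ^ 2 / 2 + M.pressure B * (U x 1 - B 1)
          - M.s * (M.internalEnergy (U x) - M.internalEnergy B)
          - M.q * (reactantFlux M U x - M.s * B 3) := by
      simp only [Model.internalEnergy]
      linear_combination h2 - U x 1 * h1 - M.q * h4
    rw [← h5]
    field_simp
  · rw [h3]; ring

theorem tendsto_waveCoord (h : IsStrongDetonation Ti M U Um Up)
    (hl : l = atTop ∨ l = atBot) (hB : Tendsto U l (𝓝 B)) (hp : 0 < B 0) :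
    Tendsto (waveCoord M B U) l (𝓝 0) := by
  have h0 : (0 : ℝ × ℝ × ℝ × ℝ) = (B 1 - B 1, M.internalEnergy B - M.internalEnergy B,
    B 3 - B 3, M.s * B 3 - M.s * B 3) := by simp only [sub_self]; rfl
  rw [h0]
  exact ((tendsto_apply hB 1).sub_const _).prodMk_nhds
    (((tendsto_internalEnergy hB).sub_const _).prodMk_nhds
      (((tendsto_apply hB 3).sub_const _).prodMk_nhds
        ((h.tendsto_reactantFlux hl hB hp).sub_const _)))

end Endstate

end IsStrongDetonation

/-! ### Estimates on a compact set of parameters -/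

section
variable {E F : Type*} [NormedAddCommGroup E] [NormedSpace ℝ E] [NormedAddCommGroup F]
  [NormedSpace ℝ F]

theorem IsC1Param.comp_right {f : ℝ → ℝ → F} (hf : IsC1Param f) {g : ℝ → ℝ} (hg : Continuous g) :
    IsC1Param fun ε x => f ε (g x) where
  continuous := hf.continuous.comp (continuous_fst.prodMk (hg.comp continuous_snd))
  differentiable x := hf.differentiable (g x)
  continuous_deriv := hf.continuous_deriv.comp (continuous_fst.prodMk (hg.comp continuous_snd))

/-- Near the endstate the observables `f k` inherit the decay of the orbits `W` and of their
differences, with the same rate for all `k`; between the endstate and `x = 0` they are bounded by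
compactness. -/
theorem exp_decay_on_compact [FiniteDimensional ℝ E] {f : ℕ → ℝ → ℝ → F}
    (hf : ∀ k, IsC1Param (f k)) {W : ℝ → ℝ → E} {Ψ : ℕ → E × ℝ → F}
    (hΨ : ∀ k, ContDiff ℝ 2 (Ψ k)) (hΨ0 : ∀ k ε, Ψ k (0, ε) = 0)
    (hW : ∀ ε₀, ∃ η > 0, ∃ L, ∃ C > 0, ∃ N ∈ 𝓝 ε₀, ∀ ε ∈ N, ∀ ε' ∈ N, ∀ x ≤ L,
      ‖W ε x‖ ≤ C * Real.exp (η * x) ∧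
      ‖W ε x - W ε' x‖ ≤ C * |ε - ε'| * Real.exp (η * x))
    (hfW : ∀ ε₀, ∃ L, ∀ᶠ ε in 𝓝 ε₀, ∀ x ≤ L, ∀ k, f k ε x = Ψ k (W ε x, ε))
    {K : Set ℝ} (hK : IsCompact K) :
    ∃ η > 0, ∀ k, ∃ C > 0, ∀ ε ∈ K, ∀ x ≤ 0, ‖f k ε x‖ ≤ C * Real.exp (η * x) ∧
      ‖deriv (fun e => f k e x) ε‖ ≤ C * Real.exp (η * x) := by
  -- the estimates near each parameter are combined on `K`
  have hunif : ∃ η > 0, ∃ L ≤ 0, ∃ C > 0, ∀ ε ∈ K, ∀ᶠ ε' in 𝓝 ε, ∀ x ≤ L,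
      ‖W ε' x‖ ≤ C * Real.exp (η * x) ∧
      ‖W ε' x - W ε x‖ ≤ C * |ε' - ε| * Real.exp (η * x) ∧
      ∀ k, f k ε' x = Ψ k (W ε' x, ε') := by
    refine hK.induction_on (p := fun S => ∃ η > 0, ∃ L ≤ 0, ∃ C > 0, ∀ ε ∈ S,
      ∀ᶠ ε' in 𝓝 ε, ∀ x ≤ L, ‖W ε' x‖ ≤ C * Real.exp (η * x) ∧
      ‖W ε' x - W ε x‖ ≤ C * |ε' - ε| * Real.exp (η * x) ∧
      ∀ k, f k ε' x = Ψ k (W ε' x, ε')) ?_ ?_ ?_ ?_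
    · exact ⟨1, one_pos, 0, le_rfl, 1, one_pos, by simp⟩
    · rintro s t hst ⟨η, hη, L, hL, C, hC, h⟩
      exact ⟨η, hη, L, hL, C, hC, fun ε hε => h ε (hst hε)⟩
    · rintro s t ⟨η, hη, L, hL, C, hC, h⟩ ⟨η', hη', L', hL', C', hC', h'⟩
      have hmono : ∀ η₁ C₁ A x : ℝ, min η η' ≤ η₁ → C₁ ≤ max C C' → 0 ≤ A → x ≤ 0 →
          C₁ * A * Real.exp (η₁ * x) ≤ max C C' * A * Real.exp (min η η' * x) := by
        intro η₁ C₁ A x h1 h2 hA hx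
        have : 0 ≤ max C C' := hC.le.trans (le_max_left _ _)
        gcongr ?_ * _ * Real.exp ?_
        exact mul_le_mul_of_nonpos_right h1 hx
      have hmono' : ∀ η₁ C₁ x : ℝ, min η η' ≤ η₁ → C₁ ≤ max C C' → x ≤ 0 →
          C₁ * Real.exp (η₁ * x) ≤ max C C' * Real.exp (min η η' * x) := fun η₁ C₁ x h1 h2 hx => by
        simpa using hmono η₁ C₁ 1 x h1 h2 zero_le_one hx
      refine ⟨min η η', lt_min hη hη', min L L', (min_le_left _ _).trans hL, max C C',
        lt_max_of_lt_left hC, ?_⟩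
      rintro ε (hε | hε)
      · filter_upwards [h ε hε] with ε' H x hx
        have hxL := hx.trans (min_le_left L L')
        obtain ⟨a, b, d⟩ := H x hxL
        exact ⟨a.trans (hmono' _ _ x (min_le_left _ _) (le_max_left _ _) (hxL.trans hL)),
          b.trans (hmono _ _ _ x (min_le_left _ _) (le_max_left _ _) (abs_nonneg _)
            (hxL.trans hL)), d⟩
      · filter_upwards [h' ε hε] with ε' H x hx
        have hxL := hx.trans (min_le_right L L')
        obtain ⟨a, b, d⟩ := H x hxL
        exact ⟨a.trans (hmono' _ _ x (min_le_right _ _) (le_max_right _ _) (hxL.trans hL')),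
          b.trans (hmono _ _ _ x (min_le_right _ _) (le_max_right _ _) (abs_nonneg _)
            (hxL.trans hL')), d⟩
    · intro ε₀ _
      obtain ⟨η, hη, L, C, hC, N, hN, h⟩ := hW ε₀
      obtain ⟨L', hL'⟩ := hfW ε₀
      obtain ⟨T, hT, hTo, hεT⟩ := eventually_nhds_iff.1 (hL'.and hN)
      refine ⟨T, mem_nhdsWithin_of_mem_nhds (hTo.mem_nhds hεT), η, hη, min (min L L') 0,
        min_le_right _ _, C, hC, fun ε hε => ?_⟩
      filter_upwards [hTo.mem_nhds hε] with ε' hε' x hx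
      have hxL : x ≤ min L L' := hx.trans (min_le_left _ _)
      obtain ⟨a, b⟩ := h ε' (hT ε' hε').2 ε (hT ε hε).2 x (hxL.trans (min_le_left _ _))
      exact ⟨a, b, (hT ε' hε').1 x (hxL.trans (min_le_right _ _))⟩
  obtain ⟨η, hη, L, hL, C, hC, h⟩ := hunif
  obtain ⟨r, hr⟩ := hK.exists_bound_of_continuousOn continuous_id.continuousOn
  refine ⟨η, hη, fun k => ?_⟩
  set R : ℝ := max C (r + 1) with hR
  obtain ⟨C₁, hC₁, H⟩ := exists_norm_sub_le_of_contDiff (hΨ k) (hΨ0 k) R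
  have hcomp := hK.prod (isCompact_Icc (a := L) (b := 0))
  obtain ⟨b₁, hb₁⟩ := hcomp.exists_bound_of_continuousOn (hf k).continuous.continuousOn
  obtain ⟨b₂, hb₂⟩ := hcomp.exists_bound_of_continuousOn (hf k).continuous_deriv.continuousOn
  refine ⟨2 * (C₁ * C) + (|b₁| + |b₂|) * Real.exp (-(η * L)), by positivity,
    fun ε hε x hx => ?_⟩
  have hex := Real.exp_pos (η * x)
  rcases le_total x L with hxL | hxL
  · -- near the endstate
    have hx1 : Real.exp (η * x) ≤ 1 := Real.exp_le_one_iff.2 (by nlinarith)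
    have hle : 2 * (C₁ * C) * Real.exp (η * x)
        ≤ (2 * (C₁ * C) + (|b₁| + |b₂|) * Real.exp (-(η * L))) * Real.exp (η * x) := by
      gcongr
      have : 0 ≤ (|b₁| + |b₂|) * Real.exp (-(η * L)) := by positivity
      linarith
    have hCe : C * Real.exp (η * x) ≤ C := by nlinarith
    have hCR : C ≤ R := le_max_left _ _
    have hεr : |ε| ≤ r := hr ε hε
    have hεR : |ε| ≤ R := hεr.trans (by linarith [le_max_right C (r + 1)])
    obtain ⟨h1, -, h3⟩ := (h ε hε).self_of_nhds x hxL
    constructor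
    · have := H (W ε x) 0 ε ε (h1.trans (hCe.trans hCR)) (by simpa using hC.le.trans hCR) hεR hεR
      rw [hΨ0, sub_zero, sub_zero, norm_zero, mul_zero, add_zero, ← h3 k] at this
      refine le_trans ?_ hle
      calc _ ≤ C₁ * (C * Real.exp (η * x)) := this.trans (by gcongr)
        _ ≤ _ := by
          have : 0 ≤ C₁ * C * Real.exp (η * x) := by positivity
          linarith
    · refine le_trans (norm_deriv_le_of_lip' (by positivity) ?_) hle
      filter_upwards [h ε hε, Metric.ball_mem_nhds ε one_pos] with ε' hε' hd
      obtain ⟨h4, h5, h6⟩ := hε' x hxL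
      have hd' : |ε' - ε| < 1 := by simpa [Real.dist_eq] using hd
      have hεR' : |ε'| ≤ R := by
        have := abs_sub_abs_le_abs_sub ε' ε
        linarith [le_max_right C (r + 1)]
      have := H (W ε' x) (W ε x) ε' ε (h4.trans (hCe.trans hCR)) (h1.trans (hCe.trans hCR))
        hεR' hεR
      rw [← h6 k, ← h3 k] at this
      rw [Real.norm_eq_abs]
      calc _ ≤ C₁ * (C * |ε' - ε| * Real.exp (η * x) + |ε' - ε| * (C * Real.exp (η * x))) :=
            this.trans (by gcongr)
        _ = _ := by ring
  · -- between the endstate and the origin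
    have hx1 : 1 ≤ Real.exp (-(η * L)) * Real.exp (η * x) := by
      rw [← Real.exp_add]
      exact Real.one_le_exp (by nlinarith)
    have hle : ∀ b, b ≤ |b₁| + |b₂| →
        b ≤ (2 * (C₁ * C) + (|b₁| + |b₂|) * Real.exp (-(η * L))) * Real.exp (η * x) := by
      intro b hb
      have h1 : 0 ≤ 2 * (C₁ * C) * Real.exp (η * x) := by positivity
      have h2 : |b₁| + |b₂| ≤ (|b₁| + |b₂|) * (Real.exp (-(η * L)) * Real.exp (η * x)) :=
        le_mul_of_one_le_right (by positivity) hx1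
      nlinarith
    exact ⟨hle _ ((hb₁ (ε, x) ⟨hε, hxL, hx⟩).trans
        ((le_abs_self _).trans (le_add_of_nonneg_right (abs_nonneg _)))),
      hle _ ((hb₂ (ε, x) ⟨hε, hxL, hx⟩).trans
        ((le_abs_self _).trans (le_add_of_nonneg_left (abs_nonneg _))))⟩

end

/-! ### Quadratic forms adapted to the linearizations -/

section Form

/-- The symmetric bilinear form on `ℝ × ℝ × ℝ × ℝ` with the diagonal blocks
`(a₁₁, a₁₂; a₁₂, a₂₂)` and `(a₃₃, a₃₄; a₃₄, a₄₄)`. -/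
noncomputable def blockForm (a₁₁ a₁₂ a₂₂ a₃₃ a₃₄ a₄₄ : ℝ) :
    ℝ × ℝ × ℝ × ℝ →L[ℝ] ℝ × ℝ × ℝ × ℝ →L[ℝ] ℝ :=
  let π₁ := ContinuousLinearMap.fst ℝ ℝ (ℝ × ℝ × ℝ)
  let σ₁ := ContinuousLinearMap.snd ℝ ℝ (ℝ × ℝ × ℝ)
  let π₂ := (ContinuousLinearMap.fst ℝ ℝ (ℝ × ℝ)).comp σ₁
  let σ₂ := (ContinuousLinearMap.snd ℝ ℝ (ℝ × ℝ)).comp σ₁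
  let π₃ := (ContinuousLinearMap.fst ℝ ℝ ℝ).comp σ₂
  let π₄ := (ContinuousLinearMap.snd ℝ ℝ ℝ).comp σ₂
  π₁.smulRight (a₁₁ • π₁ + a₁₂ • π₂) + π₂.smulRight (a₁₂ • π₁ + a₂₂ • π₂)
    + (π₃.smulRight (a₃₃ • π₃ + a₃₄ • π₄) + π₄.smulRight (a₃₄ • π₃ + a₄₄ • π₄))

theorem blockForm_apply (a₁₁ a₁₂ a₂₂ a₃₃ a₃₄ a₄₄ : ℝ) (v w : ℝ × ℝ × ℝ × ℝ) :
    blockForm a₁₁ a₁₂ a₂₂ a₃₃ a₃₄ a₄₄ v w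
      = v.1 * (a₁₁ * w.1 + a₁₂ * w.2.1) + v.2.1 * (a₁₂ * w.1 + a₂₂ * w.2.1)
        + (v.2.2.1 * (a₃₃ * w.2.2.1 + a₃₄ * w.2.2.2)
          + v.2.2.2 * (a₃₄ * w.2.2.1 + a₄₄ * w.2.2.2)) := by
  simp [blockForm]
  ring

theorem blockForm_symm (a₁₁ a₁₂ a₂₂ a₃₃ a₃₄ a₄₄ : ℝ) (v w : ℝ × ℝ × ℝ × ℝ) :
    blockForm a₁₁ a₁₂ a₂₂ a₃₃ a₃₄ a₄₄ v w = blockForm a₁₁ a₁₂ a₂₂ a₃₃ a₃₄ a₄₄ w v := by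
  simp only [blockForm_apply]
  ring

/-- The determinant of the gas-dynamical block of the linearization at an endstate is a multiple of
`g s + Γ p`, which vanishes only if the endstate is sonic. -/
theorem eq_zero_of_det_ne_zero {g p Γ s x r : ℝ} (hΓ : 0 < Γ) (hdet : g * s + Γ * p ≠ 0)
    (h1 : Γ * r + g * x = 0) (h2 : p * x - s * r = 0) : x = 0 ∧ r = 0 := by
  have hx : x = 0 := by
    have : (g * s + Γ * p) * x = 0 := by linear_combination s * h1 + Γ * h2
    exact (mul_eq_zero.1 this).resolve_left hdet
  refine ⟨hx, ?_⟩
  rw [hx, mul_zero, add_zero] at h1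
  exact (mul_eq_zero.1 h1).resolve_left hΓ.ne'

/-- A quadratic form adapted to the linearization at a burned endstate. Each of the two diagonal
blocks of the linearization is symmetric up to a positive diagonal factor; the coupling through
`q` is absorbed by a large weight on the second block. -/
theorem exists_blockForm_pos {g p Γ ν s b m K q : ℝ} (hp : 0 < p) (hΓ : 0 < Γ) (hν : 0 < ν)
    (hb : 0 < b) (hm : 0 < m) (hK : 0 < K) (hdet : g * s + Γ * p ≠ 0) :
    ∃ Q : ℝ × ℝ × ℝ × ℝ →L[ℝ] ℝ × ℝ × ℝ × ℝ →L[ℝ] ℝ, (∀ v w, Q v w = Q w v) ∧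
      ∀ v, v ≠ 0 → 0 < Q v ((Γ * v.2.1 + g * v.1) / ν,
        b * (p * v.1 - s * v.2.1 - q * v.2.2.2), m * (v.2.2.2 - s * v.2.2.1),
        K * v.2.2.1) := by
  obtain ⟨t, ht⟩ : ∃ t, t = 2 * (Γ * b * q ^ 2) * (1 / m + s ^ 2 / K) + 1 := ⟨_, rfl⟩
  refine ⟨blockForm (g * p) (Γ * p) (-(Γ * s)) (-(t * s)) t 0, blockForm_symm _ _ _ _ _ _, ?_⟩
  rintro ⟨x, r, z, w⟩ hv
  simp only [blockForm_apply]
  obtain ⟨X, hX⟩ : ∃ X, X = Γ * r + g * x := ⟨_, rfl⟩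
  obtain ⟨Y, hY⟩ : ∃ Y, Y = p * x - s * r := ⟨_, rfl⟩
  have hdecomp : x * (g * p * ((Γ * r + g * x) / ν) + Γ * p * (b * (p * x - s * r - q * w)))
      + r * (Γ * p * ((Γ * r + g * x) / ν) + -(Γ * s) * (b * (p * x - s * r - q * w)))
      + (z * (-(t * s) * (m * (w - s * z)) + t * (K * z))
        + w * (t * (m * (w - s * z)) + 0 * (K * z)))
      = p / ν * X ^ 2 + Γ * b / 2 * Y ^ 2 + Γ * b / 2 * (Y - q * w) ^ 2 + m * (w - s * z) ^ 2
        + K * z ^ 2 + Γ * b * q ^ 2 / 2 * (2 * (w - s * z) ^ 2 + 2 * s ^ 2 * z ^ 2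
          + (w - 2 * s * z) ^ 2)
        + 2 * (Γ * b * q ^ 2) * (K / m * z ^ 2 + s ^ 2 * m / K * (w - s * z) ^ 2) := by
    rw [ht, hX, hY]
    field_simp
    ring
  rw [hdecomp]
  by_contra! hle
  have e1 : 0 ≤ p / ν * X ^ 2 := by positivity
  have e2 : 0 ≤ Γ * b / 2 * Y ^ 2 := by positivity
  have e3 : 0 ≤ Γ * b / 2 * (Y - q * w) ^ 2 := by positivity
  have e4 : 0 ≤ m * (w - s * z) ^ 2 := by positivity
  have e5 : 0 ≤ K * z ^ 2 := by positivity
  have e6 : 0 ≤ Γ * b * q ^ 2 / 2 * (2 * (w - s * z) ^ 2 + 2 * s ^ 2 * z ^ 2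
          + (w - 2 * s * z) ^ 2) := by positivity
  have e7 : 0 ≤ 2 * (Γ * b * q ^ 2) * (K / m * z ^ 2 + s ^ 2 * m / K * (w - s * z) ^ 2) := by
    positivity
  have f1 : p / ν * X ^ 2 = 0 := by linarith
  have f2 : Γ * b / 2 * Y ^ 2 = 0 := by linarith
  have f4 : m * (w - s * z) ^ 2 = 0 := by linarith
  have f5 : K * z ^ 2 = 0 := by linarith
  have hX0 : Γ * r + g * x = 0 := by simpa [hp.ne', hν.ne', hX] using f1
  have hY0 : p * x - s * r = 0 := by simpa [hΓ.ne', hb.ne', hY] using f2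
  have hz0 : z = 0 := by simpa [hK.ne'] using f5
  have hw0 : w = 0 := by simpa [hm.ne', hz0] using f4
  obtain ⟨hx0, hr0⟩ := eq_zero_of_det_ne_zero hΓ hdet hX0 hY0
  exact hv (by rw [hx0, hr0, hz0, hw0]; rfl)

/-- A quadratic form adapted to the linearization, with reversed time, at an unburned endstate,
where the flux of the reactant is taken to relax to its value at the endstate. This removes the
zero eigenvalue of the linearization. -/
theorem exists_blockForm_neg_pos {g p Γ ν s b m q : ℝ} (hp : 0 < p) (hΓ : 0 < Γ) (hν : 0 < ν)
    (hs : 0 < s) (hb : 0 < b) (hm : 0 < m) (hdet : g * s + Γ * p ≠ 0) :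
    ∃ Q : ℝ × ℝ × ℝ × ℝ →L[ℝ] ℝ × ℝ × ℝ × ℝ →L[ℝ] ℝ, (∀ v w, Q v w = Q w v) ∧
      ∀ v, v ≠ 0 → 0 < Q v (-((Γ * v.2.1 + g * v.1) / ν,
        b * (p * v.1 - s * v.2.1 - q * v.2.2.2), m * (v.2.2.2 - s * v.2.2.1),
        -v.2.2.2)) := by
  obtain ⟨t, ht⟩ : ∃ t, t = Γ * b * q ^ 2 / 2 + m / (2 * s) + 1 := ⟨_, rfl⟩
  refine ⟨blockForm (-(g * p)) (-(Γ * p)) (Γ * s) 1 0 t, blockForm_symm _ _ _ _ _ _, ?_⟩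
  rintro ⟨x, r, z, w⟩ hv
  simp only [blockForm_apply, Prod.fst_neg, Prod.snd_neg]
  obtain ⟨X, hX⟩ : ∃ X, X = Γ * r + g * x := ⟨_, rfl⟩
  obtain ⟨Y, hY⟩ : ∃ Y, Y = p * x - s * r := ⟨_, rfl⟩
  have hdecomp : x * (-(g * p) * -((Γ * r + g * x) / ν)
        + -(Γ * p) * -(b * (p * x - s * r - q * w)))
      + r * (-(Γ * p) * -((Γ * r + g * x) / ν) + Γ * s * -(b * (p * x - s * r - q * w)))
      + (z * (1 * -(m * (w - s * z)) + 0 * - -w) + w * (0 * -(m * (w - s * z)) + t * - -w))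
      = p / ν * X ^ 2 + Γ * b / 2 * Y ^ 2 + Γ * b / 2 * (Y - q * w) ^ 2 + m * s / 2 * z ^ 2
        + m * s / 2 * (z - w / s) ^ 2 + w ^ 2 := by
    rw [ht, hX, hY]
    field_simp
    ring
  rw [hdecomp]
  by_contra! hle
  have e1 : 0 ≤ p / ν * X ^ 2 := by positivity
  have e2 : 0 ≤ Γ * b / 2 * Y ^ 2 := by positivity
  have e3 : 0 ≤ Γ * b / 2 * (Y - q * w) ^ 2 := by positivity
  have e4 : 0 ≤ m * s / 2 * z ^ 2 := by positivity
  have e5 : 0 ≤ m * s / 2 * (z - w / s) ^ 2 := by positivity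
  have e6 : 0 ≤ w ^ 2 := by positivity
  have f1 : p / ν * X ^ 2 = 0 := by linarith
  have f2 : Γ * b / 2 * Y ^ 2 = 0 := by linarith
  have f4 : m * s / 2 * z ^ 2 = 0 := by linarith
  have f6 : w ^ 2 = 0 := by linarith
  have hX0 : Γ * r + g * x = 0 := by simpa [hp.ne', hν.ne', hX] using f1
  have hY0 : p * x - s * r = 0 := by simpa [hΓ.ne', hb.ne', hY] using f2
  have hz0 : z = 0 := by simpa [hm.ne', hs.ne'] using f4
  have hw0 : w = 0 := by simpa using f6
  obtain ⟨hx0, hr0⟩ := eq_zero_of_det_ne_zero hΓ hdet hX0 hY0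
  exact hv (by rw [hx0, hr0, hz0, hw0]; rfl)

end Form

/-! ### Regularity of a family of detonations in the parameter -/

/-- The perturbation `U - B` of the endstate `B` in terms of the coordinates `waveCoord`. -/
noncomputable def ofWaveCoord (M : Model) (B : State) (W : ℝ × ℝ × ℝ × ℝ) : State :=
  ![-(W.1 / M.s), W.1, W.2.1 + (B 1 * W.1 + W.1 ^ 2 / 2) + M.q * W.2.2.1, W.2.2.1]

namespace IsStrongDetonationFamily

variable {c Γ Ti : ℝ} {M : ℝ → Model} {U : ℝ → (ℝ →ᵇ State)} {Um Up B : ℝ → State}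
  {l : Filter ℝ}

theorem contDiff_endstate [NeBot l] (hU : IsStrongDetonationFamily c Γ Ti M U Um Up)
    (hB : ∀ ε, Tendsto (U ε) l (𝓝 (B ε))) : ContDiff ℝ ∞ B := by
  obtain ⟨Λ, hΛ⟩ := exists_continuousLinearMap_eq_of_tendsto (F := State) l
  have : B = fun ε => Λ (U ε) := funext fun ε => (hΛ _ _ (hB ε)).symm
  rw [this]
  exact Λ.contDiff.comp hU.smooth_U

theorem contDiff_internalEnergy (hU : IsStrongDetonationFamily c Γ Ti M U Um Up) :
    ContDiff ℝ ∞ fun p : State × ℝ => (M p.2).internalEnergy p.1 := by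
  have hq : ContDiff ℝ ∞ fun p : State × ℝ => (M p.2).q := hU.smooth_q.comp contDiff_snd
  simp only [Model.internalEnergy]
  fun_prop

theorem contDiff_rate (hU : IsStrongDetonationFamily c Γ Ti M U Um Up) :
    ContDiff ℝ ∞ fun p : State × ℝ =>
      (M p.2).k * (M p.2).φ ((M p.2).temperature p.1) * p.1 3 := by
  have hT : ContDiff ℝ ∞ fun p : State × ℝ => (M p.2).temperature p.1 := by
    simp only [Model.temperature, hU.specificHeat]
    exact hU.contDiff_internalEnergy.div_const c
  exact ((hU.smooth_k.comp contDiff_snd).mul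
    (hU.smooth_φ.comp (contDiff_snd.prodMk hT))).mul (by fun_prop)

theorem contDiff_pressure (hU : IsStrongDetonationFamily c Γ Ti M U Um Up)
    (hB : ContDiff ℝ ∞ B) (hp : ∀ ε, 0 < B ε 0) :
    ContDiff ℝ ∞ fun ε => (M ε).pressure (B ε) := by
  simp only [Model.pressure, hU.gruneisen]
  exact (contDiff_const.mul (hU.contDiff_internalEnergy.comp (hB.prodMk contDiff_id))).div
    (contDiff_pi.1 hB 0) fun ε => (hp ε).ne'

theorem contDiff_profileField (hU : IsStrongDetonationFamily c Γ Ti M U Um Up)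
    (hB : ContDiff ℝ ∞ B) (hp : ∀ ε, 0 < B ε 0) {ρ : (ℝ × ℝ × ℝ × ℝ) × ℝ → ℝ}
    (hρ : ContDiff ℝ ∞ ρ) :
    ContDiff ℝ ∞ fun p : (ℝ × ℝ × ℝ × ℝ) × ℝ => profileField (M p.2) (B p.2) (ρ p) p.1 := by
  have hs : ContDiff ℝ ∞ fun p : (ℝ × ℝ × ℝ × ℝ) × ℝ => (M p.2).s :=
    hU.smooth_s.comp contDiff_snd
  have hν : ContDiff ℝ ∞ fun p : (ℝ × ℝ × ℝ × ℝ) × ℝ => (M p.2).ν :=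
    hU.smooth_ν.comp contDiff_snd
  have hκ : ContDiff ℝ ∞ fun p : (ℝ × ℝ × ℝ × ℝ) × ℝ => (M p.2).κ :=
    hU.smooth_κ.comp contDiff_snd
  have hd : ContDiff ℝ ∞ fun p : (ℝ × ℝ × ℝ × ℝ) × ℝ => (M p.2).d :=
    hU.smooth_d.comp contDiff_snd
  have hq : ContDiff ℝ ∞ fun p : (ℝ × ℝ × ℝ × ℝ) × ℝ => (M p.2).q :=
    hU.smooth_q.comp contDiff_snd
  have hP : ContDiff ℝ ∞ fun p : (ℝ × ℝ × ℝ × ℝ) × ℝ => (M p.2).pressure (B p.2) :=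
    (hU.contDiff_pressure hB hp).comp contDiff_snd
  have hB0 : ContDiff ℝ ∞ fun p : (ℝ × ℝ × ℝ × ℝ) × ℝ => B p.2 0 :=
    (contDiff_pi.1 hB 0).comp contDiff_snd
  have ns : ∀ p : (ℝ × ℝ × ℝ × ℝ) × ℝ, (M p.2).s ≠ 0 := fun p => (hU.detonation _).speed_pos.ne'
  have nν : ∀ p : (ℝ × ℝ × ℝ × ℝ) × ℝ, (M p.2).ν ≠ 0 := fun p =>
    (hU.detonation _).viscosity_pos.ne'
  have nκ : ∀ p : (ℝ × ℝ × ℝ × ℝ) × ℝ, (M p.2).κ ≠ 0 := fun p =>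
    (hU.detonation _).conduction_pos.ne'
  have nd : ∀ p : (ℝ × ℝ × ℝ × ℝ) × ℝ, (M p.2).d ≠ 0 := fun p =>
    (hU.detonation _).diffusion_pos.ne'
  simp only [profileField, hU.specificHeat, hU.gruneisen]
  fun_prop (disch := assumption)

theorem contDiff_ofWaveCoord (hU : IsStrongDetonationFamily c Γ Ti M U Um Up)
    (hB : ContDiff ℝ ∞ B) :
    ContDiff ℝ ∞ fun p : (ℝ × ℝ × ℝ × ℝ) × ℝ => ofWaveCoord (M p.2) (B p.2) p.1 := by
  have hs : ContDiff ℝ ∞ fun p : (ℝ × ℝ × ℝ × ℝ) × ℝ => (M p.2).s :=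
    hU.smooth_s.comp contDiff_snd
  have hq : ContDiff ℝ ∞ fun p : (ℝ × ℝ × ℝ × ℝ) × ℝ => (M p.2).q :=
    hU.smooth_q.comp contDiff_snd
  have hB1 : ContDiff ℝ ∞ fun p : (ℝ × ℝ × ℝ × ℝ) × ℝ => B p.2 1 :=
    (contDiff_pi.1 hB 1).comp contDiff_snd
  have ns : ∀ p : (ℝ × ℝ × ℝ × ℝ) × ℝ, (M p.2).s ≠ 0 := fun p => (hU.detonation _).speed_pos.ne'
  refine contDiff_pi.2 fun i => ?_
  fin_cases i <;>
    simp only [ofWaveCoord, Fin.zero_eta, Fin.mk_one, Fin.reduceFinMk, Matrix.cons_val] <;>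
    fun_prop (disch := assumption)

theorem sub_eq_ofWaveCoord [NeBot l] (hU : IsStrongDetonationFamily c Γ Ti M U Um Up)
    (hB : ∀ ε, Tendsto (U ε) l (𝓝 (B ε))) (ε x : ℝ) :
    U ε x - B ε = ofWaveCoord (M ε) (B ε) (waveCoord (M ε) (B ε) (U ε) x) := by
  have h := (hU.detonation ε).volume_eq (hB ε) x
  ext i
  fin_cases i
  · simp [ofWaveCoord, waveCoord, h]
  · simp [ofWaveCoord, waveCoord]
  · simp [ofWaveCoord, waveCoord, Model.internalEnergy]
    ring
  · simp [ofWaveCoord, waveCoord]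

/-- The profiles converge to their endstates locally uniformly in the parameter. -/
theorem eventually_norm_sub_le (hU : IsStrongDetonationFamily c Γ Ti M U Um Up)
    (hB : ∀ ε, Tendsto (U ε) l (𝓝 (B ε))) (hBc : Continuous B) (ε₀ : ℝ) {δ : ℝ} (hδ : 0 < δ) :
    ∃ S ∈ l, ∀ᶠ ε in 𝓝 ε₀, ∀ x ∈ S, ‖U ε x - B ε‖ ≤ δ := by
  have h3 : 0 < δ / 3 := by positivity
  refine ⟨{x | ‖U ε₀ x - B ε₀‖ < δ / 3}, ?_, ?_⟩
  · have := (((hB ε₀).sub_const (B ε₀)).norm)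
    rw [sub_self, norm_zero] at this
    exact this.eventually (gt_mem_nhds h3)
  · have h1 := (hU.smooth_U.continuous.tendsto ε₀).eventually (Metric.ball_mem_nhds _ h3)
    have h2 := (hBc.tendsto ε₀).eventually (Metric.ball_mem_nhds _ h3)
    filter_upwards [h1, h2] with ε h1 h2 x hx
    rw [dist_eq_norm] at h1 h2
    have h4 : ‖U ε x - U ε₀ x‖ ≤ ‖U ε - U ε₀‖ := (U ε - U ε₀).norm_coe_le_norm x
    have h5 : U ε x - B ε = (U ε x - U ε₀ x) + (U ε₀ x - B ε₀) - (B ε - B ε₀) := by abel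
    rw [h5]
    have hx' : ‖U ε₀ x - B ε₀‖ < δ / 3 := hx
    linarith [norm_sub_le (U ε x - U ε₀ x + (U ε₀ x - B ε₀)) (B ε - B ε₀),
      norm_add_le (U ε x - U ε₀ x) (U ε₀ x - B ε₀)]

theorem eventually_internalEnergy_sub_le (hU : IsStrongDetonationFamily c Γ Ti M U Um Up)
    (hB : ∀ ε, Tendsto (U ε) l (𝓝 (B ε))) (hBc : Continuous B) (ε₀ : ℝ) {δ : ℝ} (hδ : 0 < δ) :
    ∃ S ∈ l, ∀ᶠ ε in 𝓝 ε₀, ∀ x ∈ S,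
      |(M ε).internalEnergy (U ε x) - (M ε).internalEnergy (B ε)| ≤ δ := by
  have hq : Continuous fun p : State × ℝ => (M p.2).internalEnergy (B p.2 + p.1)
      - (M p.2).internalEnergy (B p.2) :=
    (hU.contDiff_internalEnergy.continuous.comp
      (((hBc.comp continuous_snd).add continuous_fst).prodMk continuous_snd)).sub
    (hU.contDiff_internalEnergy.continuous.comp ((hBc.comp continuous_snd).prodMk continuous_snd))
  have h1 := (hq.tendsto ((0 : State), ε₀)).eventually (Metric.ball_mem_nhds _ hδ)
  obtain ⟨r, hr, h2⟩ := Metric.eventually_nhds_iff_ball.1 h1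
  obtain ⟨S, hS, h3⟩ := hU.eventually_norm_sub_le hB hBc ε₀ (half_pos hr)
  refine ⟨S, hS, ?_⟩
  filter_upwards [h3, Metric.ball_mem_nhds ε₀ hr] with ε h4 h5 x hx
  have := h2 (U ε x - B ε, ε) (by
    rw [mem_ball_iff_norm] at h5 ⊢
    rw [Prod.mk_sub_mk, sub_zero, Prod.norm_mk]
    exact max_lt ((h4 x hx).trans_lt (by linarith)) h5)
  simp only [add_sub_cancel, add_zero, sub_self, dist_zero_right, Real.norm_eq_abs] at this
  exact this.le

/-- Far to the right the gas is not ignited, locally uniformly in the parameter. -/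
theorem eventually_temperature_lt (hc : 0 < c) (hU : IsStrongDetonationFamily c Γ Ti M U Um Up)
    (hTp : ∀ ε, (M ε).temperature (Up ε) < Ti) (ε₀ : ℝ) :
    ∃ L, ∀ᶠ ε in 𝓝 ε₀, ∀ x ≥ L, (M ε).temperature (U ε x) < Ti := by
  have hB := fun ε => (hU.detonation ε).tendsto_right
  have hUp := (hU.contDiff_endstate hB).continuous
  have hT : Continuous fun ε => (M ε).temperature (Up ε) := by
    simp only [Model.temperature, hU.specificHeat]
    exact (hU.contDiff_internalEnergy.continuous.comp (hUp.prodMk continuous_id)).div_const c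
  set δ := (Ti - (M ε₀).temperature (Up ε₀)) / 2 with hδ
  have hδ0 : 0 < δ := by linarith [hTp ε₀]
  obtain ⟨S, hS, h1⟩ := hU.eventually_internalEnergy_sub_le hB hUp ε₀
    (mul_pos hc hδ0)
  obtain ⟨L, hL⟩ := mem_atTop_sets.1 hS
  refine ⟨L, ?_⟩
  filter_upwards [h1, (hT.tendsto ε₀).eventually (gt_mem_nhds
    (show (M ε₀).temperature (Up ε₀) < Ti - δ by linarith))] with ε h2 h3 x hx
  have h4 := (abs_le.1 (h2 x (hL x hx))).2
  simp only [Model.temperature, hU.specificHeat] at h3 ⊢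
  rw [div_lt_iff₀ hc] at h3 ⊢
  linarith

theorem reactantFlux_eq_of_temperature_lt (hU : IsStrongDetonationFamily c Γ Ti M U Um Up)
    {ε L : ℝ} (hL : ∀ x ≥ L, (M ε).temperature (U ε x) < Ti) {x : ℝ} (hx : L ≤ x) :
    reactantFlux (M ε) (U ε) x = (M ε).s := by
  have h := hU.detonation ε
  have hconst : ∀ y ≥ L, reactantFlux (M ε) (U ε) y = reactantFlux (M ε) (U ε) L := by
    intro y hy
    refine constant_of_has_deriv_right_zero
      (fun z _ => (h.hasDerivAt_reactantFlux z).continuousAt.continuousWithinAt)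
      (fun z hz => ?_) y ⟨hy, le_rfl⟩
    have := h.hasDerivAt_reactantFlux z
    rw [h.ignition.eq_zero _ (hL z hz.1).le, mul_zero, zero_mul] at this
    exact this.hasDerivWithinAt
  have hlim := h.tendsto_reactantFlux (Or.inl rfl) h.tendsto_right h.physical_right.volume_pos
  rw [h.unburned_right, mul_one] at hlim
  rw [hconst x hx]
  refine tendsto_nhds_unique (tendsto_const_nhds.congr' ?_) hlim
  filter_upwards [eventually_ge_atTop L] with y hy using (hconst y hy).symm

theorem isC1Param_profile (hU : IsStrongDetonationFamily c Γ Ti M U Um Up) :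
    IsC1Param fun ε x => U ε x :=
  IsC1Param.of_boundedContinuousFunction (hU.smooth_U.of_le (by norm_cast))

/-- The flux of the reactant is its value `s` in the unignited region minus an integral of the
reaction rate; this gives its regularity in the parameter. -/
theorem isC1Param_reactantFlux (hc : 0 < c) (hU : IsStrongDetonationFamily c Γ Ti M U Um Up)
    (hTp : ∀ ε, (M ε).temperature (Up ε) < Ti) :
    IsC1Param fun ε x => reactantFlux (M ε) (U ε) x := by
  have h1 : (1 : ℕ∞ω) ≤ ∞ := by norm_cast
  have hH := hU.isC1Param_profile.comp (hU.contDiff_rate.of_le h1)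
  refine IsC1Param.of_local fun ε₀ => ?_
  obtain ⟨L, hL⟩ := hU.eventually_temperature_lt hc hTp ε₀
  refine ⟨_, ((IsC1Param.of_contDiff (hU.smooth_s.of_le h1)).prodMk (hH.integral L)).comp
    (Θ := fun p : (ℝ × ℝ) × ℝ => p.1.1 + p.1.2) (by fun_prop), ?_⟩
  filter_upwards [hL] with ε hε x
  have hcont : Continuous fun t => (M ε).k * (M ε).φ ((M ε).temperature (U ε t)) * U ε t 3 :=
    hH.continuous.comp (continuous_const.prodMk continuous_id)
  have := intervalIntegral.integral_eq_sub_of_hasDerivAt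
    (fun t _ => (hU.detonation ε).hasDerivAt_reactantFlux t)
    (hcont.intervalIntegrable L x)
  rw [hU.reactantFlux_eq_of_temperature_lt hε le_rfl] at this
  rw [this]
  ring

theorem isC1Param_waveCoord [NeBot l] (hc : 0 < c)
    (hU : IsStrongDetonationFamily c Γ Ti M U Um Up)
    (hTp : ∀ ε, (M ε).temperature (Up ε) < Ti) (hB : ∀ ε, Tendsto (U ε) l (𝓝 (B ε))) :
    IsC1Param fun ε x => waveCoord (M ε) (B ε) (U ε) x := by
  have h1 : (1 : ℕ∞ω) ≤ ∞ := by norm_cast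
  have hBs := hU.contDiff_endstate hB
  have hBi : ∀ i, ContDiff ℝ 1 fun p : (State × ℝ) × ℝ => B p.2 i := fun i =>
    ((contDiff_pi.1 hBs i).comp contDiff_snd).of_le h1
  have hs : ContDiff ℝ 1 fun p : (State × ℝ) × ℝ => (M p.2).s :=
    (hU.smooth_s.comp contDiff_snd).of_le h1
  have he : ContDiff ℝ 1 fun p : (State × ℝ) × ℝ => (M p.2).internalEnergy p.1.1 :=
    (hU.contDiff_internalEnergy.comp
      ((contDiff_fst.comp contDiff_fst).prodMk contDiff_snd)).of_le h1
  have heB : ContDiff ℝ 1 fun p : (State × ℝ) × ℝ => (M p.2).internalEnergy (B p.2) :=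
    (hU.contDiff_internalEnergy.comp ((hBs.comp contDiff_snd).prodMk contDiff_snd)).of_le h1
  have hi : ∀ i, ContDiff ℝ 1 fun p : (State × ℝ) × ℝ => p.1.1 i := fun i => by fun_prop
  exact (hU.isC1Param_profile.prodMk (hU.isC1Param_reactantFlux hc hTp)).comp
    (Θ := fun p : (State × ℝ) × ℝ => ((p.1.1 1 - B p.2 1,
      (M p.2).internalEnergy p.1.1 - (M p.2).internalEnergy (B p.2), p.1.1 3 - B p.2 3,
      p.1.2 - (M p.2).s * B p.2 3) : ℝ × ℝ × ℝ × ℝ))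
    (((hi 1).sub (hBi 1)).prodMk ((he.sub heB).prodMk (((hi 3).sub (hBi 3)).prodMk
      ((contDiff_snd.comp contDiff_fst).sub (hs.mul (hBi 3))))))

end IsStrongDetonationFamily

/-! ### Linearization at the endstates -/

/-- The reaction rate in the coordinates `waveCoord`. -/
noncomputable def reactionRate (M : Model) (B : State) (W : ℝ × ℝ × ℝ × ℝ) : ℝ :=
  M.k * M.φ ((M.internalEnergy B + W.2.1) / M.c) * (B 3 + W.2.2.1)

theorem reactionRate_waveCoord (M : Model) (B : State) (U : ℝ → State) (x : ℝ) :
    reactionRate M B (waveCoord M B U x) = M.k * M.φ (M.temperature (U x)) * U x 3 := by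
  simp [reactionRate, waveCoord, Model.temperature]

theorem hasDerivAt_prod_fst {E F : Type*} [NormedAddCommGroup E] [NormedSpace ℝ E]
    [NormedAddCommGroup F] [NormedSpace ℝ F] {f : ℝ → E × F} {f' : E × F} {t : ℝ}
    (h : HasDerivAt f f' t) : HasDerivAt (fun t => (f t).1) f'.1 t :=
  (hasFDerivAt_fst (𝕜 := ℝ) (p := f t)).comp_hasDerivAt t h

theorem hasDerivAt_prod_snd {E F : Type*} [NormedAddCommGroup E] [NormedSpace ℝ E]
    [NormedAddCommGroup F] [NormedSpace ℝ F] {f : ℝ → E × F} {f' : E × F} {t : ℝ}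
    (h : HasDerivAt f f' t) : HasDerivAt (fun t => (f t).2) f'.2 t :=
  (hasFDerivAt_snd (𝕜 := ℝ) (p := f t)).comp_hasDerivAt t h

/-- The linearization of `profileField` at the origin, along a curve through the origin. -/
theorem hasDerivAt_profileField_curve (M : Model) (B : State) {W : ℝ → ℝ × ℝ × ℝ × ℝ}
    {v : ℝ × ℝ × ℝ × ℝ} (hW : HasDerivAt W v 0) (hW0 : W 0 = 0) {ρ : ℝ → ℝ} {ρ' : ℝ}
    (hρ : HasDerivAt ρ ρ' 0) :
    HasDerivAt (fun t : ℝ => profileField M B (ρ t) (W t))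
      ((M.Γ * v.2.1 + (M.pressure B / M.s - B 0 * M.s) * v.1) / M.ν,
        M.c * B 0 / M.κ * (M.pressure B * v.1 - M.s * v.2.1 - M.q * v.2.2.2),
        B 0 ^ 2 / M.d * (v.2.2.2 - M.s * v.2.2.1), ρ') 0 := by
  have w1 := hasDerivAt_prod_fst hW
  have w2 := hasDerivAt_prod_fst (hasDerivAt_prod_snd hW)
  have w3 := hasDerivAt_prod_fst (hasDerivAt_prod_snd (hasDerivAt_prod_snd hW))
  have w4 := hasDerivAt_prod_snd (hasDerivAt_prod_snd (hasDerivAt_prod_snd hW))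
  have hτ := (w1.div_const M.s).const_sub (B 0)
  have h1 := ((((w2.const_mul M.Γ).sub (w1.const_mul (B 0 * M.s))).add
    (w1.const_mul (M.pressure B / M.s))).add (w1.pow 2)).div_const M.ν
  have h2 := ((hτ.const_mul M.c).div_const M.κ).mul ((((((w1.pow 2).const_mul M.s).div_const
    2).add (w1.const_mul (M.pressure B))).sub (w2.const_mul M.s)).sub (w4.const_mul M.q))
  have h3 := ((hτ.pow 2).div_const M.d).mul (w4.sub (w3.const_mul M.s))
  refine (h1.prodMk (h2.prodMk (h3.prodMk hρ))).congr_deriv ?_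
  simp [hW0]
  ring

theorem fderiv_profileField {M : ℝ → Model} {B : ℝ → State} {ρ : (ℝ × ℝ × ℝ × ℝ) × ℝ → ℝ}
    {ε₀ ρ' : ℝ} (hΦ : DifferentiableAt ℝ
      (fun p : (ℝ × ℝ × ℝ × ℝ) × ℝ => profileField (M p.2) (B p.2) (ρ p) p.1) (0, ε₀))
    {v : ℝ × ℝ × ℝ × ℝ} (hρ : HasDerivAt (fun t : ℝ => ρ (t • v, ε₀)) ρ' 0) :
    fderiv ℝ (fun p : (ℝ × ℝ × ℝ × ℝ) × ℝ => profileField (M p.2) (B p.2) (ρ p) p.1)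
        (0, ε₀) (v, 0)
      = (((M ε₀).Γ * v.2.1 + ((M ε₀).pressure (B ε₀) / (M ε₀).s - B ε₀ 0 * (M ε₀).s) * v.1)
          / (M ε₀).ν,
        (M ε₀).c * B ε₀ 0 / (M ε₀).κ
          * ((M ε₀).pressure (B ε₀) * v.1 - (M ε₀).s * v.2.1 - (M ε₀).q * v.2.2.2),
        B ε₀ 0 ^ 2 / (M ε₀).d * (v.2.2.2 - (M ε₀).s * v.2.2.1), ρ') := by
  have hv : HasDerivAt (fun t : ℝ => t • v) v 0 := by
    simpa using (hasDerivAt_id (0 : ℝ)).smul_const v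
  have hline : HasDerivAt (fun t : ℝ => (t • v, ε₀)) (v, (0 : ℝ)) 0 :=
    hv.prodMk (hasDerivAt_const (0 : ℝ) ε₀)
  have h1 := HasFDerivAt.comp_hasDerivAt_of_eq (0 : ℝ) hΦ.hasFDerivAt hline (by simp)
  exact h1.unique (hasDerivAt_profileField_curve (M ε₀) (B ε₀) hv (zero_smul ℝ v) hρ)

/-- `σ² τ = (Γ + 1) p`, which relates the Lax conditions to the determinant `g s + Γ p`. -/
theorem soundSpeed_sq_mul {M : Model} {B : State} (hΓ : 0 < M.Γ) (hB : M.IsPhysical B) :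
    M.soundSpeed B ^ 2 * B 0 = (M.Γ + 1) * M.pressure B := by
  have := hB.volume_pos.ne'
  have he := hB.internalEnergy_pos
  rw [Model.soundSpeed, div_pow, Real.sq_sqrt (by positivity), Model.pressure]
  field_simp

theorem pressure_pos {M : Model} {B : State} (hΓ : 0 < M.Γ) (hB : M.IsPhysical B) :
    0 < M.pressure B :=
  div_pos (mul_pos hΓ hB.internalEnergy_pos) hB.volume_pos

theorem det_ne_zero_of_ne_soundSpeed {M : Model} {B : State} (hΓ : 0 < M.Γ) (hs : 0 < M.s)
    (hB : M.IsPhysical B) (h : M.s ≠ M.soundSpeed B) :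
    (M.pressure B / M.s - B 0 * M.s) * M.s + M.Γ * M.pressure B ≠ 0 := by
  intro h0
  have h1 := soundSpeed_sq_mul hΓ hB
  have h2 : (M.pressure B / M.s - B 0 * M.s) * M.s = M.pressure B - B 0 * M.s ^ 2 := by
    field_simp
  have h3 : B 0 * (M.soundSpeed B ^ 2 - M.s ^ 2) = 0 := by rw [h2] at h0; linarith
  have h4 := (mul_eq_zero.1 h3).resolve_left hB.volume_pos.ne'
  have h5 : 0 ≤ M.soundSpeed B := div_nonneg (Real.sqrt_nonneg _) hB.volume_pos.le
  exact h ((pow_left_inj₀ hs.le h5 two_ne_zero).1 (by linarith))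

theorem profileField_zero (M : Model) (B : State) : profileField M B 0 0 = 0 := by
  simp [profileField]

theorem ofWaveCoord_zero (M : Model) (B : State) : ofWaveCoord M B 0 = 0 := by
  ext i
  fin_cases i <;> simp [ofWaveCoord]

theorem reactionRate_zero_left {Ti : ℝ} {M : Model} {U : ℝ → State} {Um Up : State}
    (h : IsStrongDetonation Ti M U Um Up) : reactionRate M Um 0 = 0 := by
  simp [reactionRate, h.burned_left]

/-! ### Exponential convergence to the endstates -/

namespace IsStrongDetonationFamily

variable {c Γ Ti : ℝ} {M : ℝ → Model} {U : ℝ → (ℝ →ᵇ State)} {Um Up B : ℝ → State}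
  {l : Filter ℝ}

theorem contDiff_reactionRate (hU : IsStrongDetonationFamily c Γ Ti M U Um Up)
    (hB : ContDiff ℝ ∞ B) :
    ContDiff ℝ ∞ fun p : (ℝ × ℝ × ℝ × ℝ) × ℝ => reactionRate (M p.2) (B p.2) p.1 := by
  have heB : ContDiff ℝ ∞ fun p : (ℝ × ℝ × ℝ × ℝ) × ℝ => (M p.2).internalEnergy (B p.2) :=
    hU.contDiff_internalEnergy.comp ((hB.comp contDiff_snd).prodMk contDiff_snd)
  have hB3 : ContDiff ℝ ∞ fun p : (ℝ × ℝ × ℝ × ℝ) × ℝ => B p.2 3 :=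
    (contDiff_pi.1 hB 3).comp contDiff_snd
  simp only [reactionRate, hU.specificHeat]
  exact ((hU.smooth_k.comp contDiff_snd).mul (hU.smooth_φ.comp (contDiff_snd.prodMk
    ((heB.add (by fun_prop)).div_const c)))).mul (hB3.add (by fun_prop))

theorem hasDerivAt_waveCoord (hc : 0 < c) (hU : IsStrongDetonationFamily c Γ Ti M U Um Up)
    (hl : l = atTop ∨ l = atBot) (hB : ∀ ε, Tendsto (U ε) l (𝓝 (B ε))) (hp : ∀ ε, 0 < B ε 0)
    (ε x : ℝ) :
    HasDerivAt (waveCoord (M ε) (B ε) (U ε)) (profileField (M ε) (B ε)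
      (reactionRate (M ε) (B ε) (waveCoord (M ε) (B ε) (U ε) x))
      (waveCoord (M ε) (B ε) (U ε) x)) x := by
  rw [reactionRate_waveCoord]
  exact (hU.detonation ε).hasDerivAt_waveCoord (by rw [hU.specificHeat]; exact hc.ne') hl (hB ε)
    (hp ε) x

/-- All derivatives of the profiles in `x` are smooth functions of `waveCoord` and of the parameter,
hence continuously differentiable in the parameter. -/
theorem isC1Param_iteratedDeriv (hc : 0 < c) (hU : IsStrongDetonationFamily c Γ Ti M U Um Up)
    (hTp : ∀ ε, (M ε).temperature (Up ε) < Ti)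
    (hl : l = atTop ∨ l = atBot) (hB : ∀ ε, Tendsto (U ε) l (𝓝 (B ε))) (hp : ∀ ε, 0 < B ε 0)
    (k : ℕ) : IsC1Param fun ε x => iteratedDeriv k (fun y => U ε y - B ε) x := by
  have : NeBot l := by rcases hl with rfl | rfl <;> infer_instance
  have hBs := hU.contDiff_endstate hB
  have hΦ := hU.contDiff_profileField hBs hp (hU.contDiff_reactionRate hBs)
  have hG := hU.contDiff_ofWaveCoord hBs
  have h1 : ∀ ε x, iteratedDeriv k (fun y => U ε y - B ε) x = _ := fun ε x =>
    iteratedDeriv_eq_flowDeriv_iterate (ε := ε) hΦ hG isOpen_univ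
      (fun x _ => hU.hasDerivAt_waveCoord hc hl hB hp ε x)
      (fun x _ => hU.sub_eq_ofWaveCoord hB ε x) k x (Set.mem_univ x)
  simp only [h1]
  exact (hU.isC1Param_waveCoord hc hTp hB).comp
    ((contDiff_flowDeriv_iterate hΦ hG k).of_le (by norm_cast))

/-- At the burned end the flux of the reactant is controlled through its monotonicity in `x`. -/
theorem eventually_norm_waveCoord_left_le (hc : 0 < c)
    (hU : IsStrongDetonationFamily c Γ Ti M U Um Up)
    (hTp : ∀ ε, (M ε).temperature (Up ε) < Ti) (ε₀ : ℝ) {δ : ℝ} (hδ : 0 < δ) :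
    ∃ L, ∀ᶠ ε in 𝓝 ε₀, ∀ x ≤ L, ‖waveCoord (M ε) (Um ε) (U ε) x‖ ≤ δ := by
  have hB := fun ε => (hU.detonation ε).tendsto_left
  have hBc := (hU.contDiff_endstate hB).continuous
  obtain ⟨S, hS, h1⟩ := hU.eventually_norm_sub_le hB hBc ε₀ hδ
  obtain ⟨S', hS', h2⟩ := hU.eventually_internalEnergy_sub_le hB hBc ε₀ hδ
  have hlim : ∀ ε, Tendsto (reactantFlux (M ε) (U ε)) atBot (𝓝 0) := fun ε => by
    have h := hU.detonation ε
    simpa [h.burned_left] using h.tendsto_reactantFlux (Or.inr rfl) h.tendsto_left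
      h.physical_left.volume_pos
  obtain ⟨L, hL⟩ := mem_atBot_sets.1 (inter_mem (inter_mem hS hS')
    ((hlim ε₀).eventually (gt_mem_nhds hδ)))
  have hcont : Continuous fun ε => reactantFlux (M ε) (U ε) L :=
    ((hU.isC1Param_reactantFlux hc hTp).differentiable L).continuous
  refine ⟨L, ?_⟩
  filter_upwards [h1, h2, (hcont.tendsto ε₀).eventually (gt_mem_nhds (hL L le_rfl).2)]
    with ε h1 h2 h3 x hx
  have h4 := h1 x (hL x hx).1.1
  have hi : ∀ i, ‖U ε x i - Um ε i‖ ≤ δ := fun i => (norm_le_pi_norm (U ε x - Um ε) i).trans h4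
  have hmono := (hU.detonation ε).monotone_reactantFlux
  have h5 : 0 ≤ reactantFlux (M ε) (U ε) x :=
    le_of_tendsto (hlim ε) ((eventually_le_atBot x).mono fun y hy => hmono hy)
  refine max_le (hi 1) (max_le (h2 x (hL x hx).1.2) (max_le (hi 3) ?_))
  have h6 : (waveCoord (M ε) (Um ε) (U ε) x).2.2.2 = reactantFlux (M ε) (U ε) x := by
    simp [waveCoord, (hU.detonation ε).burned_left]
  rw [h6, Real.norm_eq_abs, abs_of_nonneg h5]
  exact (hmono hx).trans h3.le

theorem waveCoord_right_eq (hU : IsStrongDetonationFamily c Γ Ti M U Um Up) {ε L : ℝ}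
    (hL : ∀ x ≥ L, (M ε).temperature (U ε x) < Ti) {x : ℝ} (hx : L ≤ x) :
    (waveCoord (M ε) (Up ε) (U ε) x).2.2.2 = 0 := by
  simp [waveCoord, hU.reactantFlux_eq_of_temperature_lt hL hx, (hU.detonation ε).unburned_right]

theorem eventually_norm_waveCoord_right_le (hc : 0 < c)
    (hU : IsStrongDetonationFamily c Γ Ti M U Um Up)
    (hTp : ∀ ε, (M ε).temperature (Up ε) < Ti) (ε₀ : ℝ) {δ : ℝ} (hδ : 0 < δ) :
    ∃ L, ∀ᶠ ε in 𝓝 ε₀, ∀ x ≥ L, ‖waveCoord (M ε) (Up ε) (U ε) x‖ ≤ δ := by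
  have hB := fun ε => (hU.detonation ε).tendsto_right
  have hBc := (hU.contDiff_endstate hB).continuous
  obtain ⟨S, hS, h1⟩ := hU.eventually_norm_sub_le hB hBc ε₀ hδ
  obtain ⟨S', hS', h2⟩ := hU.eventually_internalEnergy_sub_le hB hBc ε₀ hδ
  obtain ⟨L, hL⟩ := mem_atTop_sets.1 (inter_mem hS hS')
  obtain ⟨L', hL'⟩ := hU.eventually_temperature_lt hc hTp ε₀
  refine ⟨max L L', ?_⟩
  filter_upwards [h1, h2, hL'] with ε h1 h2 h3 x hx
  have hxL : L ≤ x := (le_max_left _ _).trans hx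
  have h4 := h1 x (hL x hxL).1
  have hi : ∀ i, ‖U ε x i - Up ε i‖ ≤ δ := fun i => (norm_le_pi_norm (U ε x - Up ε) i).trans h4
  refine max_le (hi 1) (max_le (h2 x (hL x hxL).2) (max_le (hi 3) ?_))
  rw [hU.waveCoord_right_eq h3 ((le_max_right _ _).trans hx), norm_zero]
  exact hδ.le

/-- Decay at the burned endstate, where the linearization is hyperbolic. -/
theorem exp_decay_left (hc : 0 < c) (hΓ : 0 < Γ)
    (hU : IsStrongDetonationFamily c Γ Ti M U Um Up)
    (hTp : ∀ ε, (M ε).temperature (Up ε) < Ti) {K : Set ℝ} (hK : IsCompact K) :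
    ∃ η > 0, ∀ k, ∃ C > 0, ∀ ε ∈ K, ∀ x ≤ 0,
      ‖iteratedDeriv k (fun y => U ε y - Um ε) x‖ ≤ C * Real.exp (η * x) ∧
      ‖deriv (fun e => iteratedDeriv k (fun y => U e y - Um e) x) ε‖ ≤ C * Real.exp (η * x) := by
  have hl : (atBot : Filter ℝ) = atTop ∨ (atBot : Filter ℝ) = atBot := Or.inr rfl
  have hB := fun ε => (hU.detonation ε).tendsto_left
  have hp := fun ε => (hU.detonation ε).physical_left.volume_pos
  have hBs := hU.contDiff_endstate hB
  have hΦ := hU.contDiff_profileField hBs hp (hU.contDiff_reactionRate hBs)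
  have hG := hU.contDiff_ofWaveCoord hBs
  have h2 : (2 : ℕ∞ω) ≤ ∞ := by norm_cast
  have hΦ0 : ∀ ε, profileField (M ε) (Um ε) (reactionRate (M ε) (Um ε) 0) 0 = 0 := fun ε => by
    rw [reactionRate_zero_left (hU.detonation ε), profileField_zero]
  refine exp_decay_on_compact (fun k => hU.isC1Param_iteratedDeriv hc hTp hl hB hp k)
    (W := fun ε x => waveCoord (M ε) (Um ε) (U ε) x)
    (fun k => (contDiff_flowDeriv_iterate hΦ hG k).of_le h2)
    (fun k ε => flowDeriv_iterate_zero hΦ0 (fun ε => ofWaveCoord_zero _ _) k ε) ?_ ?_ hK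
  · intro ε₀
    have h := hU.detonation ε₀
    have hcM : 0 < (M ε₀).c := by rw [hU.specificHeat]; exact hc
    have hΓM : 0 < (M ε₀).Γ := by rw [hU.gruneisen]; exact hΓ
    have hτ := hp ε₀
    have hκ := h.conduction_pos
    have hd := h.diffusion_pos
    have hk := h.rate_pos
    have hφ := h.ignition.pos _ h.ignited_left
    obtain ⟨Q, hsymm, hpos⟩ := exists_blockForm_pos (b := (M ε₀).c * Um ε₀ 0 / (M ε₀).κ)
      (m := Um ε₀ 0 ^ 2 / (M ε₀).d) (K := (M ε₀).k * (M ε₀).φ ((M ε₀).temperature (Um ε₀)))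
      (q := (M ε₀).q) (pressure_pos hΓM h.physical_left) hΓM h.viscosity_pos (by positivity)
      (by positivity) (by positivity)
      (det_ne_zero_of_ne_soundSpeed hΓM h.speed_pos h.physical_left h.lax_left.ne)
    refine eventually_exp_decay (hΦ.of_le h2) hΦ0 Q hsymm (fun v hv => ?_)
      (fun ε => (hU.detonation ε).tendsto_waveCoord hl (hB ε) (hp ε))
      (fun δ hδ => hU.eventually_norm_waveCoord_left_le hc hTp ε₀ hδ)
      ⟨0, Eventually.of_forall fun ε x _ => hU.hasDerivAt_waveCoord hc hl hB hp ε x⟩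
      (fun x => ((hU.isC1Param_waveCoord hc hTp hB).contDiff x).contDiffAt)
    rw [fderiv_profileField (ρ' := (M ε₀).k * (M ε₀).φ ((M ε₀).temperature (Um ε₀)) * v.2.2.1)
      (hΦ.differentiable (by simp) _)]
    · exact hpos v hv
    · have hf : DifferentiableAt ℝ (fun t : ℝ => (M ε₀).k * (M ε₀).φ
          (((M ε₀).internalEnergy (Um ε₀) + (t • v).2.1) / (M ε₀).c)) 0 := by
        have := h.ignition.smooth.differentiable (by simp)
        simp only [Prod.smul_fst, Prod.smul_snd]
        fun_prop
      have hg : HasDerivAt (fun t : ℝ => Um ε₀ 3 + (t • v).2.2.1) v.2.2.1 0 := by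
        simpa using ((hasDerivAt_id (0 : ℝ)).mul_const v.2.2.1).const_add (Um ε₀ 3)
      refine (hf.hasDerivAt.mul hg).congr_deriv ?_
      simp [h.burned_left, Model.temperature]
  · exact fun ε₀ => ⟨0, Eventually.of_forall fun ε x _ k =>
      iteratedDeriv_eq_flowDeriv_iterate (ε := ε) hΦ hG isOpen_univ
        (fun x _ => hU.hasDerivAt_waveCoord hc hl hB hp ε x)
        (fun x _ => hU.sub_eq_ofWaveCoord hB ε x) k x (Set.mem_univ x)⟩

/-- Decay at the unburned endstate, where the linearization has the eigenvalue `0`. The flux of the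
reactant is constant there, so that the profile also solves the equation whose linearization is
stable; `x` is reflected to apply the estimates at `-∞`. -/
theorem exp_decay_right (hc : 0 < c) (hΓ : 0 < Γ)
    (hU : IsStrongDetonationFamily c Γ Ti M U Um Up)
    (hTp : ∀ ε, (M ε).temperature (Up ε) < Ti) {K : Set ℝ} (hK : IsCompact K) :
    ∃ η > 0, ∀ k, ∃ C > 0, ∀ ε ∈ K, ∀ x ≤ 0,
      ‖iteratedDeriv k (fun y => U ε y - Up ε) (-x)‖ ≤ C * Real.exp (η * x) ∧
      ‖deriv (fun e => iteratedDeriv k (fun y => U e y - Up e) (-x)) ε‖ ≤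
        C * Real.exp (η * x) := by
  have hl : (atTop : Filter ℝ) = atTop ∨ (atTop : Filter ℝ) = atBot := Or.inl rfl
  have hB := fun ε => (hU.detonation ε).tendsto_right
  have hp := fun ε => (hU.detonation ε).physical_right.volume_pos
  have hBs := hU.contDiff_endstate hB
  -- the field with the flux of the reactant relaxing, which agrees with the true one where the
  -- flux of the reactant has the value of the endstate and the gas is not ignited
  have hΦ := hU.contDiff_profileField hBs hp (ρ := fun p => -p.1.2.2.2) (by fun_prop)
  have hG := hU.contDiff_ofWaveCoord hBs
  have h2 : (2 : ℕ∞ω) ≤ ∞ := by norm_cast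
  have hΦ0 : ∀ ε, profileField (M ε) (Up ε) (-(0 : ℝ × ℝ × ℝ × ℝ).2.2.2) 0 = 0 := fun ε => by
    simpa using profileField_zero (M ε) (Up ε)
  have hode : ∀ ε L, (∀ x ≥ L, (M ε).temperature (U ε x) < Ti) → ∀ x ≥ L,
      HasDerivAt (waveCoord (M ε) (Up ε) (U ε)) (profileField (M ε) (Up ε)
        (-(waveCoord (M ε) (Up ε) (U ε) x).2.2.2) (waveCoord (M ε) (Up ε) (U ε) x)) x := by
    intro ε L hL x hx
    have := hU.hasDerivAt_waveCoord hc hl hB hp ε x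
    rwa [reactionRate_waveCoord, (hU.detonation ε).ignition.eq_zero _ (hL x hx).le, mul_zero,
      zero_mul, ← neg_zero, ← hU.waveCoord_right_eq hL hx] at this
  refine exp_decay_on_compact
    (fun k => (hU.isC1Param_iteratedDeriv hc hTp hl hB hp k).comp_right continuous_neg)
    (W := fun ε x => waveCoord (M ε) (Up ε) (U ε) (-x))
    (fun k => (contDiff_flowDeriv_iterate hΦ hG k).of_le h2)
    (fun k ε => flowDeriv_iterate_zero hΦ0 (fun ε => ofWaveCoord_zero _ _) k ε) ?_ ?_ hK
  · intro ε₀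
    have h := hU.detonation ε₀
    have hcM : 0 < (M ε₀).c := by rw [hU.specificHeat]; exact hc
    have hΓM : 0 < (M ε₀).Γ := by rw [hU.gruneisen]; exact hΓ
    have hτ := hp ε₀
    have hκ := h.conduction_pos
    have hd := h.diffusion_pos
    obtain ⟨Q, hsymm, hpos⟩ := exists_blockForm_neg_pos (b := (M ε₀).c * Up ε₀ 0 / (M ε₀).κ)
      (m := Up ε₀ 0 ^ 2 / (M ε₀).d) (q := (M ε₀).q) (pressure_pos hΓM h.physical_right) hΓM
      h.viscosity_pos h.speed_pos (by positivity) (by positivity)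
      (det_ne_zero_of_ne_soundSpeed hΓM h.speed_pos h.physical_right h.lax_right.ne')
    refine eventually_exp_decay (Φ := fun p => -profileField (M p.2) (Up p.2) (-p.1.2.2.2) p.1)
      (hΦ.of_le h2).neg (fun ε => by rw [hΦ0, neg_zero]) Q hsymm (fun v hv => ?_)
      (fun ε => ((hU.detonation ε).tendsto_waveCoord hl (hB ε) (hp ε)).comp
        tendsto_neg_atBot_atTop)
      (fun δ hδ => ?_) ?_
      (fun x => ((hU.isC1Param_waveCoord hc hTp hB).contDiff (-x)).contDiffAt)
    · rw [fderiv_fun_neg, neg_apply,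
        fderiv_profileField (ρ' := -v.2.2.2) (hΦ.differentiable (by simp) _)]
      · exact hpos v hv
      · simpa using ((hasDerivAt_id (0 : ℝ)).mul_const v.2.2.2).fun_neg
    · obtain ⟨L, hL⟩ := hU.eventually_norm_waveCoord_right_le hc hTp ε₀ hδ
      exact ⟨-L, hL.mono fun ε h x hx => h (-x) (by linarith)⟩
    · obtain ⟨L, hL⟩ := hU.eventually_temperature_lt hc hTp ε₀
      refine ⟨-L, hL.mono fun ε h x hx => ?_⟩
      have := (hode ε L h (-x) (by linarith)).scomp x (hasDerivAt_neg x)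
      simpa [Function.comp_def] using this
  · intro ε₀
    obtain ⟨L, hL⟩ := hU.eventually_temperature_lt hc hTp ε₀
    refine ⟨-(L + 1), hL.mono fun ε h x hx k => ?_⟩
    exact iteratedDeriv_eq_flowDeriv_iterate (ε := ε) hΦ hG (isOpen_Ioi (a := L))
      (fun x hx => hode ε L h x (le_of_lt hx))
      (fun x _ => hU.sub_eq_ofWaveCoord hB ε x) k (-x) (Set.mem_Ioi.2 (by linarith))

/-- Exponential convergence of the profiles and of their derivatives, locally uniformly in the
parameter. -/
theorem exists_mixedDeriv_le (hc : 0 < c) (hΓ : 0 < Γ)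
    (hU : IsStrongDetonationFamily c Γ Ti M U Um Up)
    (hTp : ∀ ε, (M ε).temperature (Up ε) < Ti) {K : Set ℝ} (hK : IsCompact K) :
    ∃ η₀ : ℝ, 0 < η₀ ∧ ∀ k : ℕ, ∃ C : ℝ, 0 < C ∧ ∀ j ≤ 1, ∀ ε ∈ K, ∀ x : ℝ,
      (x < 0 → ‖mixedDeriv U Um j k ε x‖ ≤ C * Real.exp (-η₀ * |x|)) ∧
      (0 < x → ‖mixedDeriv U Up j k ε x‖ ≤ C * Real.exp (-η₀ * |x|)) := by
  obtain ⟨η₁, hη₁, h1⟩ := hU.exp_decay_left hc hΓ hTp hK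
  obtain ⟨η₂, hη₂, h2⟩ := hU.exp_decay_right hc hΓ hTp hK
  refine ⟨min η₁ η₂, lt_min hη₁ hη₂, fun k => ?_⟩
  obtain ⟨C₁, hC₁, h1⟩ := h1 k
  obtain ⟨C₂, hC₂, h2⟩ := h2 k
  have hle₁ : ∀ x ≤ 0, C₁ * Real.exp (η₁ * x) ≤ max C₁ C₂ * Real.exp (min η₁ η₂ * x) := by
    intro x hx
    gcongr ?_ * Real.exp ?_
    · exact le_max_left _ _
    · exact mul_le_mul_of_nonpos_right (min_le_left _ _) hx
  have hle₂ : ∀ x ≤ 0, C₂ * Real.exp (η₂ * x) ≤ max C₁ C₂ * Real.exp (min η₁ η₂ * x) := by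
    intro x hx
    gcongr ?_ * Real.exp ?_
    · exact le_max_right _ _
    · exact mul_le_mul_of_nonpos_right (min_le_right _ _) hx
  refine ⟨max C₁ C₂, lt_max_of_lt_left hC₁, fun j hj ε hε x => ⟨fun hx => ?_, fun hx => ?_⟩⟩
  · have h3 := h1 ε hε x hx.le
    rw [abs_of_neg hx, neg_mul_neg]
    refine le_trans ?_ (hle₁ x hx.le)
    interval_cases j
    · simpa [mixedDeriv] using h3.1
    · simpa [mixedDeriv] using h3.2
  · have h3 := h2 ε hε (-x) (by linarith)
    rw [neg_neg] at h3
    rw [abs_of_pos hx, neg_mul_comm]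
    refine le_trans ?_ (hle₂ (-x) (by linarith))
    interval_cases j
    · simpa [mixedDeriv] using h3.1
    · simpa [mixedDeriv] using h3.2

end IsStrongDetonationFamily

/-! ### The travelling-wave field at the unburned endstate -/

/-- The coordinates `waveCoord` of a point `X = (u, E, z, z')` of the phase space. -/
noncomputable def phaseCoord (M : Model) (B : State) (X : Fin 4 → ℝ) : ℝ × ℝ × ℝ × ℝ :=
  (X 0 - B 1, X 1 - X 0 ^ 2 / 2 - M.q * X 2 - M.internalEnergy B, X 2 - B 3,
    M.d / (B 0 - (X 0 - B 1) / M.s) ^ 2 * X 3 + M.s * (X 2 - B 3))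

/-- The travelling-wave field in the variables `(u, E, z, z')` without reaction, expressed through
`profileField`. -/
noncomputable def inertField (M : Model) (B : State) (X : Fin 4 → ℝ) : Fin 4 → ℝ :=
  let P := profileField M B 0 (phaseCoord M B X)
  let τ := B 0 - (X 0 - B 1) / M.s
  ![P.1, P.2.1 + X 0 * P.1 + M.q * X 3, X 3, -(M.s * τ ^ 2 / M.d + 2 * P.1 / (M.s * τ)) * X 3]

theorem waveField_eq_inertField {M : Model} {B : State} (hν : M.ν ≠ 0) (hκ : M.κ ≠ 0)
    (hd : M.d ≠ 0) (hs : M.s ≠ 0) (hc : M.c ≠ 0) (hB : B 0 ≠ 0) {X : Fin 4 → ℝ}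
    (hτ : B 0 - (X 0 - B 1) / M.s ≠ 0)
    (hφ : M.φ ((X 1 - X 0 ^ 2 / 2 - M.q * X 2) / M.c) = 0) :
    M.waveField B X = inertField M B X := by
  obtain ⟨τ, hτ'⟩ : ∃ τ, τ = B 0 - (X 0 - B 1) / M.s := ⟨_, rfl⟩
  have hX0 : X 0 = B 1 + M.s * (B 0 - τ) := by rw [hτ']; field_simp; ring
  have hX0' : X 0 - B 1 = M.s * (B 0 - τ) := by rw [hX0]; ring
  rw [← hτ'] at hτ
  have hdiv : M.s * (B 0 - τ) / M.s = B 0 - τ := by field_simp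
  have hT : M.temperature ![τ, X 0, X 1, X 2] = (X 1 - X 0 ^ 2 / 2 - M.q * X 2) / M.c := by
    simp [Model.temperature, Model.internalEnergy]
  have hp : M.pressure ![τ, X 0, X 1, X 2]
      = M.Γ * (X 1 - X 0 ^ 2 / 2 - M.q * X 2) / τ := by
    simp [Model.pressure, Model.internalEnergy]
  have hpB : M.Γ * M.internalEnergy B = M.pressure B * B 0 := by
    rw [Model.pressure]; field_simp
  obtain ⟨e, he⟩ : ∃ e, e = X 1 - X 0 ^ 2 / 2 - M.q * X 2 := ⟨_, rfl⟩
  have h1 : τ / M.ν * ((M.Γ * e / τ - M.s * X 0) - (M.pressure B - M.s * B 1))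
      = (M.Γ * (e - M.internalEnergy B) - B 0 * M.s * (X 0 - B 1)
        + M.pressure B / M.s * (X 0 - B 1) + (X 0 - B 1) ^ 2) / M.ν := by
    rw [mul_sub M.Γ, hpB, hX0]
    field_simp
    ring
  have h2 : B 2 = M.internalEnergy B + B 1 ^ 2 / 2 + M.q * B 3 := by
    rw [Model.internalEnergy]; ring
  rw [← he] at hφ hT hp
  have he1 : X 1 = e + X 0 ^ 2 / 2 + M.q * X 2 := by rw [he]; ring
  obtain ⟨a, ha⟩ : ∃ a, a = (M.Γ * (e - M.internalEnergy B) - B 0 * M.s * (X 0 - B 1)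
        + M.pressure B / M.s * (X 0 - B 1) + (X 0 - B 1) ^ 2) / M.ν := ⟨_, rfl⟩
  have ha' : a = (M.Γ * e - τ * (M.pressure B + M.s * (X 0 - B 1))) / M.ν := by
    rw [ha, ← h1]; field_simp; ring
  have h3 : M.c * τ / M.κ * ((M.Γ * e / τ * X 0 - M.s * X 1) - (M.pressure B * B 1 - M.s * B 2)
        + (M.κ / (M.c * τ) - M.d / τ ^ 2) * M.q * X 3 - (M.ν - M.κ / M.c) / τ * X 0 * a)
      = M.c * τ / M.κ * (M.s * (X 0 - B 1) ^ 2 / 2 + M.pressure B * (X 0 - B 1)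
          - M.s * (e - M.internalEnergy B) - M.q * (M.d / τ ^ 2 * X 3 + M.s * (X 2 - B 3)))
        + X 0 * a + M.q * X 3 := by
    rw [ha', h2, he1]
    field_simp
    ring
  have h4 : τ ^ 2 / M.d * (-M.s * X 3 + M.k * 0 * X 2) + 2 * (-a / M.s) / τ * X 3
      = -(M.s * τ ^ 2 / M.d + 2 * a / (M.s * τ)) * X 3 := by
    field_simp
    ring
  simp only [Model.waveField, inertField, profileField, phaseCoord, ← hτ', ← he, hT, hφ, hp, h1,
    ← ha, h3, h4]

theorem phaseCoord_endstate (M : Model) (B : State) :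
    phaseCoord M B ![B 1, B 2, B 3, 0] = 0 := by
  simp [phaseCoord, Model.internalEnergy]

theorem inertField_endstate (M : Model) (B : State) :
    inertField M B ![B 1, B 2, B 3, 0] = 0 := by
  ext i
  fin_cases i <;> simp [inertField, phaseCoord_endstate, profileField_zero]

theorem differentiableAt_inertField {M : Model} {B : State} (hs : M.s ≠ 0) (hB : B 0 ≠ 0) :
    DifferentiableAt ℝ (inertField M B) ![B 1, B 2, B 3, 0] := by
  refine differentiableAt_pi.2 fun i => ?_
  fin_cases i <;>
    simp only [inertField, profileField, phaseCoord, Fin.zero_eta, Fin.mk_one, Fin.reduceFinMk,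
      Matrix.cons_val] <;>
    fun_prop (disch := simp [hs, hB])

/-- The derivative of the travelling-wave field without reaction at the endstate, in the
direction `h`. -/
theorem hasDerivAt_inertField_line {M : Model} {B : State} (hs : M.s ≠ 0) (hB : B 0 ≠ 0)
    (h : Fin 4 → ℝ) :
    HasDerivAt (fun t : ℝ => inertField M B (![B 1, B 2, B 3, 0] + t • h))
      (let r := h 1 - B 1 * h 0 - M.q * h 2
      let a := (M.Γ * r + (M.pressure B / M.s - B 0 * M.s) * h 0) / M.ν
      ![a, M.c * B 0 / M.κ * (M.pressure B * h 0 - M.s * r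
          - M.q * (M.d / B 0 ^ 2 * h 3 + M.s * h 2)) + B 1 * a + M.q * h 3, h 3,
        -(M.s * B 0 ^ 2 / M.d) * h 3]) 0 := by
  have hlin : ∀ a b : ℝ, HasDerivAt (fun t : ℝ => a + t * b) b 0 := fun a b => by
    simpa using ((hasDerivAt_id (0 : ℝ)).mul_const b).const_add a
  have hτ := (((hlin (B 1) (h 0)).sub_const (B 1)).div_const M.s).const_sub (B 0)
  have hW : HasDerivAt (fun t : ℝ => phaseCoord M B (![B 1, B 2, B 3, 0] + t • h))
      (h 0, h 1 - B 1 * h 0 - M.q * h 2, h 2, M.d / B 0 ^ 2 * h 3 + M.s * h 2) 0 := by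
    have h1 := (hlin (B 1) (h 0)).sub_const (B 1)
    have h2 := ((((hlin (B 2) (h 1)).sub (((hlin (B 1) (h 0)).pow 2).div_const 2)).sub
      ((hlin (B 3) (h 2)).const_mul M.q)).sub_const (M.internalEnergy B))
    have h3 := (hlin (B 3) (h 2)).sub_const (B 3)
    have h4 := (((hasDerivAt_const (0 : ℝ) M.d).div (hτ.pow 2) (by simpa using hB)).mul
      (hlin 0 (h 3))).add (h3.const_mul M.s)
    refine (h1.prodMk (h2.prodMk (h3.prodMk h4))).congr_deriv ?_
    simp
    ring
  have hP0' : profileField M B 0 (phaseCoord M B ![B 1, B 2, B 3, 0]) = 0 := by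
    rw [phaseCoord_endstate, profileField_zero]
  have hW0 : phaseCoord M B (![B 1, B 2, B 3, 0] + (0 : ℝ) • h) = 0 := by
    rw [zero_smul, add_zero, phaseCoord_endstate]
  have hP := hasDerivAt_profileField_curve M B hW hW0 (hasDerivAt_const (0 : ℝ) (0 : ℝ))
  have hP1 := hasDerivAt_prod_fst hP
  have hP2 := hasDerivAt_prod_fst (hasDerivAt_prod_snd hP)
  refine hasDerivAt_pi.2 fun i => ?_
  fin_cases i
  · simpa [inertField] using hP1
  · refine ((hP2.add ((hlin (B 1) (h 0)).mul hP1)).add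
      ((hlin 0 (h 3)).const_mul M.q)).congr_deriv ?_
    simp [hP0']
  · simpa [inertField] using hlin 0 (h 3)
  · have hg := (((((hτ.pow 2).const_mul M.s).div_const M.d).add ((hP1.const_mul 2).div
      (hτ.const_mul M.s) (by simpa using ⟨hs, hB⟩))).neg).mul (hlin 0 (h 3))
    refine (hg.congr_of_eventuallyEq (Eventually.of_forall fun t => ?_)).congr_deriv ?_
    · simp [inertField]
    · simp [hP0']

namespace IsStrongDetonation

variable {Ti : ℝ} {M : Model} {U : ℝ → State} {Um Up : State}

/-- By the Rankine-Hugoniot conditions the equations may be integrated from either endstate. -/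
theorem waveField_left_eq (h : IsStrongDetonation Ti M U Um Up) (hc : M.c ≠ 0) :
    M.waveField Um = M.waveField Up := by
  have hm := h.physical_left.volume_pos
  have hp := h.physical_right.volume_pos
  have h1 : M.pressure Um - M.s * Um 1 = M.pressure Up - M.s * Up 1 := by
    linarith [h.deriv_velocity (Or.inr rfl) h.tendsto_left hm 0,
      h.deriv_velocity (Or.inl rfl) h.tendsto_right hp 0]
  have h2 : M.pressure Um * Um 1 - M.s * Um 2 = M.pressure Up * Up 1 - M.s * Up 2 := by
    linarith [h.deriv_energy hc (Or.inr rfl) h.tendsto_left hm 0,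
      h.deriv_energy hc (Or.inl rfl) h.tendsto_right hp 0]
  have h3 : ∀ a, Um 0 - (a - Um 1) / M.s = Up 0 - (a - Up 1) / M.s := fun a => by
    have e1 := h.volume_eq h.tendsto_left 0
    have e2 := h.volume_eq h.tendsto_right 0
    rw [sub_div] at e1 e2 ⊢
    rw [sub_div]
    linarith
  funext X
  simp only [Model.waveField, h1, h2, h3]

/-- Near the unburned endstate the gas is not ignited. -/
theorem eventually_waveField_eq (h : IsStrongDetonation Ti M U Um Up) (hc : M.c ≠ 0)
    (hTp : M.temperature Up < Ti) :
    ∀ᶠ X in 𝓝 ![Up 1, Up 2, Up 3, 0], M.waveField Um X = inertField M Up X := by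
  have hp := h.physical_right.volume_pos
  have hs := h.speed_pos.ne'
  have h0 : Continuous fun X : Fin 4 → ℝ => X 0 - Up 1 :=
    (continuous_apply (0 : Fin 4)).sub continuous_const
  have h1 : ContinuousAt (fun X : Fin 4 → ℝ => Up 0 - (X 0 - Up 1) / M.s)
      ![Up 1, Up 2, Up 3, 0] :=
    (continuous_const.sub (h0.div_const M.s)).continuousAt
  have h2 : ContinuousAt (fun X : Fin 4 → ℝ => (X 1 - X 0 ^ 2 / 2 - M.q * X 2) / M.c)
      ![Up 1, Up 2, Up 3, 0] :=
    ContinuousAt.div_const (by fun_prop) M.c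
  filter_upwards [h1.eventually_ne (show _ ≠ 0 by simpa using hp.ne'),
    h2.eventually (gt_mem_nhds (show _ < Ti by
      simpa [Model.temperature, Model.internalEnergy] using hTp))] with X hX1 hX2
  rw [h.waveField_left_eq hc]
  exact waveField_eq_inertField h.viscosity_pos.ne' h.conduction_pos.ne' h.diffusion_pos.ne'
    h.speed_pos.ne' hc hp.ne' hX1 (h.ignition.eq_zero _ hX2.le)

theorem fderiv_waveField (h : IsStrongDetonation Ti M U Um Up) (hc : M.c ≠ 0)
    (hTp : M.temperature Up < Ti) (w : Fin 4 → ℝ) :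
    fderiv ℝ (M.waveField Um) ![Up 1, Up 2, Up 3, 0] w =
      let r := w 1 - Up 1 * w 0 - M.q * w 2
      let a := (M.Γ * r + (M.pressure Up / M.s - Up 0 * M.s) * w 0) / M.ν
      ![a, M.c * Up 0 / M.κ * (M.pressure Up * w 0 - M.s * r
          - M.q * (M.d / Up 0 ^ 2 * w 3 + M.s * w 2)) + Up 1 * a + M.q * w 3, w 3,
        -(M.s * Up 0 ^ 2 / M.d) * w 3] := by
  have hp := h.physical_right.volume_pos.ne'
  rw [EventuallyEq.fderiv_eq (h.eventually_waveField_eq hc hTp)]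
  have hline : HasDerivAt (fun t : ℝ => ![Up 1, Up 2, Up 3, 0] + t • w) w 0 := by
    simpa using ((hasDerivAt_id (0 : ℝ)).smul_const w).const_add ![Up 1, Up 2, Up 3, 0]
  have h1 := HasFDerivAt.comp_hasDerivAt_of_eq (0 : ℝ)
    (differentiableAt_inertField h.speed_pos.ne' hp).hasFDerivAt hline (by simp)
  exact h1.unique (hasDerivAt_inertField_line h.speed_pos.ne' hp w)

theorem differentiableAt_waveField (h : IsStrongDetonation Ti M U Um Up) (hc : M.c ≠ 0)
    (hTp : M.temperature Up < Ti) :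
    DifferentiableAt ℝ (M.waveField Um) ![Up 1, Up 2, Up 3, 0] :=
  (differentiableAt_inertField h.speed_pos.ne'
    h.physical_right.volume_pos.ne').congr_of_eventuallyEq (h.eventually_waveField_eq hc hTp)

/-- The Lax condition at the unburned endstate makes the gas-dynamical block of the linearization
stable. -/
theorem det_neg_right (h : IsStrongDetonation Ti M U Um Up) (hΓ : 0 < M.Γ) :
    (M.pressure Up / M.s - Up 0 * M.s) * M.s + M.Γ * M.pressure Up < 0 := by
  have hs := h.speed_pos
  have hp := h.physical_right.volume_pos
  have h1 := soundSpeed_sq_mul hΓ h.physical_right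
  have h2 : (M.pressure Up / M.s - Up 0 * M.s) * M.s = M.pressure Up - Up 0 * M.s ^ 2 := by
    field_simp
  have h3 : 0 ≤ M.soundSpeed Up := div_nonneg (Real.sqrt_nonneg _) hp.le
  have h4 : M.soundSpeed Up ^ 2 < M.s ^ 2 := pow_lt_pow_left₀ h.lax_right h3 two_ne_zero
  rw [h2]
  nlinarith

end IsStrongDetonation

section Charpoly

open Polynomial

theorem charpoly_of_block (a b c d x y z w m : ℂ) :
    (!![a, b, x, y; c, d, z, w; 0, 0, 0, 1; 0, 0, 0, m] : Matrix (Fin 4) (Fin 4) ℂ).charpoly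
      = X * ((X - C m) * (X ^ 2 - C (a + d) * X + C (a * d - b * c))) := by
  simp only [Matrix.charpoly, Matrix.charmatrix, Matrix.det_succ_row_zero, Fin.sum_univ_succ]
  simp [Fin.succAbove, Matrix.submatrix]
  ring

/-- A real monic quadratic polynomial with negative trace and positive determinant is stable. -/
theorem re_neg_of_quadratic {t D : ℝ} (ht : t < 0) (hD : 0 < D) {μ : ℂ}
    (h : μ ^ 2 - t * μ + D = 0) : μ.re < 0 := by
  have h1 := congrArg Complex.re h
  have h2 := congrArg Complex.im h
  simp [pow_two] at h1 h2
  by_contra! hre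
  have h3 : μ.im * (2 * μ.re - t) = 0 := by linarith
  have h4 : μ.im = 0 := (mul_eq_zero.1 h3).resolve_right (by linarith)
  rw [h4] at h1
  nlinarith

end Charpoly

/-! ### Center manifolds at the unburned endstate -/

namespace IsStrongDetonation

variable {Ti : ℝ} {M : Model} {U : ℝ → State} {Um Up : State}

/-- In the variables `(u, E, z, y)` the linearization is block triangular: the `(u, E)` block has
negative trace and, by the Lax condition, positive determinant, and the `(z, y)` block has the
eigenvalues `0` and `-s τ² / d`. -/
theorem hasSimpleCenter (h : IsStrongDetonation Ti M U Um Up) (hc : 0 < M.c) (hΓ : 0 < M.Γ)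
    (hTp : M.temperature Up < Ti) :
    HasSimpleCenter (M.waveField Um) ![Up 1, Up 2, Up 3, 0] := by
  have hν := h.viscosity_pos
  have hκ := h.conduction_pos
  have hd := h.diffusion_pos
  have hs := h.speed_pos
  have hτ := h.physical_right.volume_pos
  have hp := pressure_pos hΓ h.physical_right
  obtain ⟨g, hg⟩ : ∃ g, g = M.pressure Up / M.s - Up 0 * M.s := ⟨_, rfl⟩
  have hdet := h.det_neg_right hΓ
  rw [← hg] at hdet
  have hg0 : g < 0 := by
    have := mul_pos hΓ hp
    by_contra! hg0
    nlinarith [mul_nonneg hg0 hs.le]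
  set A : Matrix (Fin 4) (Fin 4) ℂ :=
    (LinearMap.toMatrix' (fderiv ℝ (M.waveField Um) ![Up 1, Up 2, Up 3, 0] :
      (Fin 4 → ℝ) →ₗ[ℝ] Fin 4 → ℝ)).map (fun a => (a : ℂ)) with hA
  have hApply : ∀ i j, A i j =
      ((fderiv ℝ (M.waveField Um) ![Up 1, Up 2, Up 3, 0] (Pi.single j 1) i : ℝ) : ℂ) := by
    intro i j
    rw [hA, Matrix.map_apply, LinearMap.toMatrix'_apply]
    congr 3
  obtain ⟨b, hb⟩ : ∃ b, b = M.c * Up 0 / M.κ := ⟨_, rfl⟩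
  have hb0 : 0 < b := by rw [hb]; positivity
  obtain ⟨m, hm⟩ : ∃ m, m = M.s * Up 0 ^ 2 / M.d := ⟨_, rfl⟩
  have hm0 : 0 < m := by rw [hm]; positivity
  have hrow : ∀ j, (A 2 j = if j = 3 then 1 else 0) ∧ (A 3 j = if j = 3 then -(m : ℂ) else 0) := by
    intro j
    rw [hApply, hApply, h.fderiv_waveField hc.ne' hTp, ← hm]
    fin_cases j <;> simp
  have htr : A 0 0 + A 1 1 = ((g / M.ν - b * M.s : ℝ) : ℂ) := by
    rw [hApply, hApply, h.fderiv_waveField hc.ne' hTp, h.fderiv_waveField hc.ne' hTp, ← hg, ← hb]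
    simp
    field_simp
    ring
  have hD : A 0 0 * A 1 1 - A 0 1 * A 1 0
      = ((-(b / M.ν) * (g * M.s + M.Γ * M.pressure Up) : ℝ) : ℂ) := by
    rw [hApply, hApply, hApply, hApply, h.fderiv_waveField hc.ne' hTp,
      h.fderiv_waveField hc.ne' hTp, ← hg, ← hb]
    simp
    field_simp
    ring
  have hchar : A.charpoly = Polynomial.X * ((Polynomial.X - Polynomial.C (-m : ℂ))
      * (Polynomial.X ^ 2 - Polynomial.C ((g / M.ν - b * M.s : ℝ) : ℂ) * Polynomial.X
        + Polynomial.C ((-(b / M.ν) * (g * M.s + M.Γ * M.pressure Up) : ℝ) : ℂ))) := by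
    rw [← htr, ← hD, ← charpoly_of_block (A 0 0) (A 0 1) (A 1 0) (A 1 1) (A 0 2) (A 0 3) (A 1 2)
      (A 1 3) (-m : ℂ)]
    congr 1
    ext i j
    fin_cases i <;> fin_cases j <;> simp [hrow]
  have ht0 : g / M.ν - b * M.s < 0 := by
    have := div_neg_of_neg_of_pos hg0 hν
    nlinarith [mul_pos hb0 hs]
  have hD0 : 0 < -(b / M.ν) * (g * M.s + M.Γ * M.pressure Up) :=
    mul_pos_of_neg_of_neg (neg_neg_of_pos (div_pos hb0 hν)) hdet
  generalize g / M.ν - b * M.s = t at *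
  generalize -(b / M.ν) * (g * M.s + M.Γ * M.pressure Up) = D at *
  refine ⟨?_, ?_, ?_⟩
  · rw [(h.eventually_waveField_eq hc.ne' hTp).self_of_nhds, inertField_endstate]
  · change A.charpoly.rootMultiplicity 0 = 1
    have hne : A.charpoly ≠ 0 := (Matrix.charpoly_monic A).ne_zero
    rw [hchar] at hne ⊢
    rw [Polynomial.rootMultiplicity_mul hne]
    have h1 : Polynomial.rootMultiplicity (0 : ℂ) Polynomial.X = 1 := by
      simpa using Polynomial.rootMultiplicity_X_sub_C_self (x := (0 : ℂ))
    rw [h1, Polynomial.rootMultiplicity_eq_zero]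
    simp [Polynomial.IsRoot, hm0.ne', hD0.ne']
  · intro μ hμ
    change A.charpoly.IsRoot μ at hμ
    rw [hchar] at hμ
    simp only [Polynomial.IsRoot, Polynomial.eval_mul, Polynomial.eval_X, Polynomial.eval_sub,
      Polynomial.eval_C, Polynomial.eval_add, Polynomial.eval_pow, mul_eq_zero] at hμ
    rcases hμ with hμ | hμ | hμ
    · exact Or.inl hμ
    · right
      rw [sub_eq_zero.1 hμ]
      simpa using hm0
    · exact Or.inr (re_neg_of_quadratic ht0 hD0 hμ)

/-- The equilibria near the unburned endstate form a curve: without reaction the balance laws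
determine the velocity from the mass fraction through a quadratic equation, whose discriminant
does not vanish by the Lax condition. -/
theorem exists_isCenterCurve (h : IsStrongDetonation Ti M U Um Up) (hc : 0 < M.c) (hΓ : 0 < M.Γ)
    (hTp : M.temperature Up < Ti) :
    ∃ γ : ℝ → Fin 4 → ℝ, IsCenterCurve (M.waveField Um) ![Up 1, Up 2, Up 3, 0] γ := by
  have hν := h.viscosity_pos
  have hs := h.speed_pos
  have hdet := h.det_neg_right hΓ
  obtain ⟨g, hg⟩ : ∃ g, g = M.pressure Up / M.s - Up 0 * M.s := ⟨_, rfl⟩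
  obtain ⟨p, hp⟩ : ∃ p, p = M.pressure Up := ⟨_, rfl⟩
  rw [← hg, ← hp] at hdet
  obtain ⟨α, hα⟩ : ∃ α, α = 1 / 2 + 1 / M.Γ := ⟨_, rfl⟩
  have hα0 : 0 < α := by rw [hα]; positivity
  obtain ⟨β, hβ⟩ : ∃ β, β = -(g * M.s + M.Γ * p) / (M.s * M.Γ) := ⟨_, rfl⟩
  have hβ0 : 0 < β := by rw [hβ]; exact div_pos (by linarith) (by positivity)
  -- the root of `α v² - β v = q t` that vanishes for `t = 0`
  set v : ℝ → ℝ := fun t => (β - Real.sqrt (β ^ 2 + 4 * α * M.q * t)) / (2 * α) with hv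
  set r : ℝ → ℝ := fun t => -(g * v t + v t ^ 2) / M.Γ with hr
  set γ : ℝ → Fin 4 → ℝ := fun t => ![Up 1 + v t,
    r t + M.internalEnergy Up + (Up 1 + v t) ^ 2 / 2 + M.q * (Up 3 + t), Up 3 + t, 0] with hγ
  have hv0 : v 0 = 0 := by simp [hv, Real.sqrt_sq hβ0.le]
  have hγ0 : γ 0 = ![Up 1, Up 2, Up 3, 0] := by
    simp [hγ, hr, hv0, Model.internalEnergy]
    ring
  have hvs : ContDiffAt ℝ 1 v 0 := by
    have h1 : ContDiffAt ℝ 1 (fun t : ℝ => Real.sqrt (β ^ 2 + 4 * α * M.q * t)) 0 :=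
      ContDiffAt.sqrt (by fun_prop) (by simpa using hβ0.ne')
    exact (contDiffAt_const.sub h1).div_const _
  have hrs : ContDiffAt ℝ 1 r 0 := (((contDiffAt_const.mul hvs).add (hvs.pow 2)).neg).div_const _
  have hγs : ContDiffAt ℝ 1 γ 0 := by
    refine contDiffAt_pi.2 fun i => ?_
    fin_cases i
    · exact contDiffAt_const.add hvs
    · exact ((hrs.add contDiffAt_const).add (((contDiffAt_const.add hvs).pow 2).div_const 2)).add
        (by fun_prop)
    · exact contDiffAt_const.add contDiffAt_id
    · exact contDiffAt_const
  have hzero : ∀ᶠ t in 𝓝 (0 : ℝ), M.waveField Um (γ t) = 0 := by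
    have h1 : ∀ᶠ t in 𝓝 (0 : ℝ), M.waveField Um (γ t) = inertField M Up (γ t) := by
      have h2 := hγs.continuousAt.tendsto
      rw [hγ0] at h2
      exact h2.eventually <| h.eventually_waveField_eq hc.ne' hTp
    have h2 : ∀ᶠ t in 𝓝 (0 : ℝ), 0 < β ^ 2 + 4 * α * M.q * t := by
      refine (show ContinuousAt (fun t : ℝ => β ^ 2 + 4 * α * M.q * t) 0 by fun_prop).eventually
        (lt_mem_nhds ?_)
      simpa using pow_pos hβ0 2
    filter_upwards [h1, h2] with t h1 h2
    have hquad : α * v t ^ 2 - β * v t = M.q * t := by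
      have h3 := Real.sq_sqrt h2.le
      obtain ⟨S, hS⟩ : ∃ S, S = Real.sqrt (β ^ 2 + 4 * α * M.q * t) := ⟨_, rfl⟩
      rw [← hS] at h3
      simp only [hv, ← hS]
      field_simp
      linear_combination h3
    have hP : profileField M Up 0 (phaseCoord M Up (γ t)) = (0, 0,
        (profileField M Up 0 (phaseCoord M Up (γ t))).2.2) := by
      have hf : M.Γ * r t + g * v t + v t ^ 2 = 0 := by
        simp only [hr]
        field_simp
        ring
      have hf2 : M.s * v t ^ 2 / 2 + p * v t - M.s * r t - M.q * (M.s * t) = 0 := by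
        simp only [hr]
        rw [hα, hβ] at hquad
        field_simp at hquad ⊢
        linear_combination hquad
      have hW : phaseCoord M Up (γ t) = (v t, r t, t, M.s * t) := by
        simp [phaseCoord, hγ]
        ring
      rw [hW]
      refine Prod.ext ?_ (Prod.ext ?_ rfl)
      · simp only [profileField]
        rw [div_eq_zero_iff]
        left
        rw [hg] at hf
        linear_combination hf
      · simp only [profileField]
        rw [mul_eq_zero]
        right
        rw [hp] at hf2
        linear_combination hf2
    have hP1 := congrArg Prod.fst hP
    have hP2 := congrArg (fun a => a.2.1) hP
    rw [h1]
    ext i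
    fin_cases i
    · simpa [inertField] using hP1
    · simp only [inertField, hP1, hP2]; simp [hγ]
    · simp [inertField, hγ]
    · simp [inertField, hγ]
  have hd := (hγs.differentiableAt one_ne_zero).hasDerivAt
  refine ⟨γ, hγs, hγ0, ?_, ?_, hzero.mono fun t ht => ⟨0, by rw [ht, zero_smul]⟩⟩
  · intro h0
    have h1 := hasDerivAt_pi.1 hd 2
    have h2 : HasDerivAt (fun t => γ t 2) 1 0 := by
      simpa [hγ] using (hasDerivAt_id (0 : ℝ)).const_add (Up 3)
    have h3 := h1.unique h2
    rw [h0] at h3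
    simp at h3
  · have h1 := HasFDerivAt.comp_hasDerivAt_of_eq (0 : ℝ)
      (h.differentiableAt_waveField hc.ne' hTp).hasFDerivAt hd hγ0.symm
    have h2 : HasDerivAt (M.waveField Um ∘ γ) 0 0 :=
      (hasDerivAt_const (0 : ℝ) (0 : Fin 4 → ℝ)).congr_of_eventuallyEq hzero
    exact h1.unique h2

/-- Every center curve consists of equilibria. If the field is `a` times the tangent of the curve,
then `a (ẏ + μ ż) = 0` with `μ > 0`, and the second factor does not vanish at the endstate, because
the kernel of the linearization is transversal to `z = const` and contained in `y = 0`. -/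
theorem eventually_waveField_eq_zero (h : IsStrongDetonation Ti M U Um Up) (hc : 0 < M.c)
    (hΓ : 0 < M.Γ) (hTp : M.temperature Up < Ti) {γ : ℝ → Fin 4 → ℝ}
    (hγ : IsCenterCurve (M.waveField Um) ![Up 1, Up 2, Up 3, 0] γ) :
    ∀ᶠ t in 𝓝 (0 : ℝ), M.waveField Um (γ t) = 0 := by
  have hν := h.viscosity_pos
  have hκ := h.conduction_pos
  have hd := h.diffusion_pos
  have hs := h.speed_pos
  have hτ := h.physical_right.volume_pos
  have hdet := (h.det_neg_right hΓ).ne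
  obtain ⟨w, hw⟩ : ∃ w, w = deriv γ 0 := ⟨_, rfl⟩
  have htan := hγ.tangent
  rw [h.fderiv_waveField hc.ne' hTp, ← hw] at htan
  have hw3 : w 3 = 0 := by simpa using congrFun htan 2
  have hw2 : w 2 ≠ 0 := by
    intro hw2
    have e0 := congrFun htan 0
    have e1 := congrFun htan 1
    simp only [hw2, hw3, Matrix.cons_val, Pi.zero_apply, mul_zero, sub_zero, add_zero] at e0 e1
    rw [e0, mul_zero, add_zero] at e1
    have e0' := (div_eq_zero_iff.1 e0).resolve_right hν.ne'
    have e1' := (mul_eq_zero.1 e1).resolve_left (by positivity)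
    obtain ⟨f0, f1⟩ := eq_zero_of_det_ne_zero hΓ hdet e0' e1'
    apply hγ.regular
    rw [← hw]
    ext i
    fin_cases i
    · exact f0
    · simpa [f0] using f1
    · exact hw2
    · exact hw3
  have hcont := hγ.smooth.continuousAt
  have hX : Tendsto γ (𝓝 0) (𝓝 ![Up 1, Up 2, Up 3, 0]) := by
    have := hcont.tendsto
    rwa [hγ.through] at this
  have hD : ContinuousAt (deriv γ) 0 := by
    have h1 := hγ.smooth.continuousAt_fderiv one_ne_zero
    have h2 : deriv γ = fun t => fderiv ℝ γ t 1 := by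
      funext t
      exact (fderiv_apply_one_eq_deriv).symm
    rw [h2]
    exact h1.clm_apply continuousAt_const
  obtain ⟨μ, hμ⟩ : ∃ μ : (Fin 4 → ℝ) → ℝ, μ = fun X =>
      M.s * (Up 0 - (X 0 - Up 1) / M.s) ^ 2 / M.d
        + 2 * (profileField M Up 0 (phaseCoord M Up X)).1
          / (M.s * (Up 0 - (X 0 - Up 1) / M.s)) := ⟨_, rfl⟩
  have hμ0 : μ ![Up 1, Up 2, Up 3, 0] = M.s * Up 0 ^ 2 / M.d := by
    simp [hμ, phaseCoord_endstate, profileField_zero]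
  have hμc : ContinuousAt μ ![Up 1, Up 2, Up 3, 0] := by
    rw [hμ]
    refine DifferentiableAt.continuousAt (𝕜 := ℝ) ?_
    simp only [profileField, phaseCoord]
    fun_prop (disch := simp [hs.ne', hτ.ne'])
  have hμγ : Tendsto (fun t => μ (γ t)) (𝓝 0) (𝓝 (M.s * Up 0 ^ 2 / M.d)) := by
    rw [← hμ0]
    exact hμc.tendsto.comp hX
  have hDi : ∀ i, Tendsto (fun t => deriv γ t i) (𝓝 0) (𝓝 (w i)) := fun i => by
    rw [hw]
    exact (continuous_apply i).continuousAt.tendsto.comp hD.tendsto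
  have hfac := (hDi 3).add (hμγ.mul (hDi 2))
  rw [hw3, zero_add] at hfac
  -- the components `z` and `y` of the invariance give `y = a ż` and `-μ y = a ẏ`
  filter_upwards [hfac.eventually_ne (mul_ne_zero (by positivity) hw2),
    (hDi 2).eventually_ne hw2, hX.eventually (h.eventually_waveField_eq hc.ne' hTp),
    hγ.invariant] with t h1 h2 h3 ⟨a, ha⟩
  have hE := ha
  rw [h3] at hE
  have e2 : γ t 3 = a * deriv γ t 2 := by simpa [inertField] using congrFun hE 2
  have e3 : -μ (γ t) * γ t 3 = a * deriv γ t 3 := by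
    rw [hμ]
    simpa [inertField] using congrFun hE 3
  have e4 : a * (deriv γ t 3 + μ (γ t) * deriv γ t 2) = 0 := by
    rw [e2] at e3
    linear_combination -e3
  rw [ha, (mul_eq_zero.1 e4).resolve_right h1, zero_smul]

end IsStrongDetonation

end Detonation

theorem mainTheorem6 (c Γ Ti : ℝ) (hc : 0 < c) (hΓ : 0 < Γ)
    (M : ℝ → Detonation.Model) (U : ℝ → (ℝ →ᵇ Detonation.State))
    (Um Up : ℝ → Detonation.State)
    (hU : Detonation.IsStrongDetonationFamily c Γ Ti M U Um Up)
    (hTp : ∀ ε, (M ε).temperature (Up ε) < Ti) :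
    -- the derivatives that are estimated below exist
    (∀ (k : ℕ) (x : ℝ),
      Differentiable ℝ (fun ε : ℝ => iteratedDeriv k (fun y : ℝ => U ε y - Um ε) x) ∧
      Differentiable ℝ (fun ε : ℝ => iteratedDeriv k (fun y : ℝ => U ε y - Up ε) x)) ∧
    -- exponential decay, locally uniformly in the parameter, with a rate that does not depend
    -- on the order of differentiation
    (∀ K : Set ℝ, IsCompact K → ∃ η₀ : ℝ, 0 < η₀ ∧ ∀ k : ℕ, ∃ C : ℝ, 0 < C ∧
      ∀ j ≤ 1, ∀ ε ∈ K, ∀ x : ℝ,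
        (x < 0 → ‖Detonation.mixedDeriv U Um j k ε x‖ ≤ C * Real.exp (-η₀ * |x|)) ∧
        (0 < x → ‖Detonation.mixedDeriv U Up j k ε x‖ ≤ C * Real.exp (-η₀ * |x|))) ∧
    -- the center direction at the unburned endstate, and its center manifolds
    (∀ ε : ℝ,
      Detonation.HasSimpleCenter ((M ε).waveField (Um ε)) ![Up ε 1, Up ε 2, Up ε 3, 0] ∧
      (∃ γ : ℝ → Fin 4 → ℝ, Detonation.IsCenterCurve ((M ε).waveField (Um ε))
        ![Up ε 1, Up ε 2, Up ε 3, 0] γ) ∧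
      ∀ γ : ℝ → Fin 4 → ℝ, Detonation.IsCenterCurve ((M ε).waveField (Um ε))
        ![Up ε 1, Up ε 2, Up ε 3, 0] γ →
          ∀ᶠ t in 𝓝 (0 : ℝ), (M ε).waveField (Um ε) (γ t) = 0) := by
  have hcM : ∀ ε, 0 < (M ε).c := fun ε => (hU.specificHeat ε).symm ▸ hc
  have hΓM : ∀ ε, 0 < (M ε).Γ := fun ε => (hU.gruneisen ε).symm ▸ hΓ
  refine ⟨fun k x => ⟨?_, ?_⟩, fun K hK => hU.exists_mixedDeriv_le hc hΓ hTp hK, fun ε => ?_⟩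
  · exact (hU.isC1Param_iteratedDeriv hc hTp (Or.inr rfl)
      (fun ε => (hU.detonation ε).tendsto_left)
      (fun ε => (hU.detonation ε).physical_left.volume_pos) k).differentiable x
  · exact (hU.isC1Param_iteratedDeriv hc hTp (Or.inl rfl)
      (fun ε => (hU.detonation ε).tendsto_right)
      (fun ε => (hU.detonation ε).physical_right.volume_pos) k).differentiable x
  · have h := hU.detonation ε
    exact ⟨h.hasSimpleCenter (hcM ε) (hΓM ε) (hTp ε),
      h.exists_isCenterCurve (hcM ε) (hΓM ε) (hTp ε),
      fun γ hγ => h.eventually_waveField_eq_zero (hcM ε) (hΓM ε) (hTp ε) hγ⟩
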